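/- **Conventions.** A rooted planar map is a finite connected graph (loops and multiple edges allowed) embedded in the sphere with a marked oriented edge (the root), up to orientation-preserving homeomorphism; equivalently, a finite set of oriented edges with the reversal involution and the counterclockwise rotation around vertices, connected and satisfying Euler's formula, up to isomorphism. An oriented edge is incident to the face on its left. A plane tree with $m$ edges is a rooted planar map with a single face and $m$ edges; its contour walk $t_0,t_1,\dots$ (indices modulo $2m$) starts with the root and follows the tree, keeping it on the left hand. The external face of a rooted map $M$ is the face to the left of the root; its boundary walk $b_0,b_1,\dots$ starts with the root and follows the external face. The boundary has size $2m$ if the external face has degree $2m$, and is bridgeless if no edge is used by the boundary walk in both directions. The other faces are internal, and an edge is internal if it is not in the boundary. **Gluing.** Let $T$ be a plane tree with $m$ edges and $M$ a map with a bridgeless boundary of size $2m$. The gluing of $T$ and $M$ is obtained by deleting the external face, keeping the internal faces, identifying $b_i$ with the reversal of $b_j$ whenever $t_j$ is the reversal of $t_i$, and identifying the starting vertices of $b_i$ and $b_j$ whenever $t_i$ and $t_j$ start at the same vertex of $T$. It is decorated by the circuit $(e_i)$ in which $e_i$ is the image of $b_i$, and its root is $e_0$. **Bubble-maps.** A bubble-map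 is a rooted graph embedded in a finite collection of spheres (bubbles) glued to each other at vertices (pinch points) in a tree-like way: each bubble carries a connected map with at least one edge, no two vertices of the same bubble are identified, and the bipartite graph of incidences between bubbles and vertices is a tree. It is a genuine map if it has no pinch point, that is, only one bubble. Its faces are the faces of the maps in its bubbles. A bubble-map decorated by a non-self-crossing circuit of length $2m$ is a bubble-map with a sequence of oriented edges $(e_i)_{i\in\mathbb Z/2m}$ such that * $e_0$ is the root, and the head of $e_i$ is the tail of $e_{i+1}$ for every $i$; * the $e_i$ are distinct, and the reversal of each $e_i$ is some $e_j$ (so each edge of the circuit is passed exactly twice, once in each direction); * the circuit does not cross itself: at every vertex, when each passage of the circuit is drawn on the right-hand side of the edges it uses, there are no $i,j$ such that $e_i,e_{j+1},e_{i+1},e_j$ appear in this cyclic order around the vertex. At a pinch point this means that the bubbles meeting there can be laid out in the plane around the point, preserving the cyclic order of the edges in each bubble and without interlacing different bubbles, so that this pattern does not occur; * the circuit passes through every pinch point, visiting there each of the bubbles that meet at this point. Decorated bubble-maps are considered up to isomorphism preserving orientation, root, vertices and circuit. **Proposition.** Let $m\in\mathbb N$. 1. Let $T$ be a plane tree with $m$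 edges and $M$ a map with a bridgeless boundary of size $2m$. If the gluing of $T$ and $M$ is a genuine map, then no vertex at which the boundary of $M$ is not simple is identified with itself by $T$: for $i\not\equiv j \pmod{2m}$ such that $b_i$ and $b_j$ start at the same vertex of $M$, the edges $t_i$ and $t_j$ start at different vertices of $T$. 2. For every $f\in\mathbb N$, the gluing is a bijection between the set of pairs formed by a plane tree with $m$ edges and a map with a bridgeless boundary of size $2m$ and $f$ internal faces, and the set of bubble-maps with $f$ faces decorated by a non-self-crossing circuit of length $2m$. 3. For every $e\in\mathbb N$, the gluing is a bijection between the set of pairs formed by a plane tree with $m$ edges and a map with a bridgeless boundary of size $2m$ and $e$ internal edges, and the set of bubble-maps with $e+m$ edges decorated by a non-self-crossing circuit of length $2m$. -/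

import Mathlib

open Equiv.Perm

/-! ## Rotation systems, planar maps, trees and maps with a boundary -/

/-- A finite rooted graph drawn on a closed oriented surface. A dart is an oriented edge, attached to
its starting vertex; `rev` reverses a dart; `rot d` is the next dart after `d` in counterclockwise
order around the starting vertex of `d`. -/
structure RotationSystem where
  Dart : Type
  finite_dart : Finite Dart
  rev : Equiv.Perm Dart
  rot : Equiv.Perm Dart
  rev_rev : ∀ d, rev (rev d) = d
  rev_ne : ∀ d, rev d ≠ d
  root : Dart

attribute [instance] RotationSystem.finite_dart

/-- The number of cycles of the permutation `p` that meet `S`. -/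
noncomputable def cycleCount {D : Type} (p : Equiv.Perm D) (S : Set D) : ℕ :=
  (Quotient.mk (SameCycle.setoid p) '' S).ncard

namespace RotationSystem

variable (X : RotationSystem)

/-- `face d` is the dart that follows `d` along the face on the left of `d`: at the head of `d`, take
the first dart in clockwise order after the reversal of `d`. The faces are the cycles of `face`,
the vertices are the cycles of `rot`, the edges are the cycles of `rev`. -/
def face : Equiv.Perm X.Dart := X.rot⁻¹ * X.rev

/-- Being in the same connected component. -/
def component : Setoid X.Dart := SameCycle.setoid X.rot ⊔ SameCycle.setoid X.rev

/-- Euler's formula for the part of the graph made of the darts of `S`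
(to be used for connected components). -/
def IsSpherical (S : Set X.Dart) : Prop :=
  cycleCount X.rot S + cycleCount X.face S = cycleCount X.rev S + 2

/-- A rooted planar map: connected, and embedded in the sphere. -/
def IsPlanarMap : Prop := X.component = ⊤ ∧ X.IsSpherical Set.univ

noncomputable def faceCount : ℕ := cycleCount X.face Set.univ

noncomputable def edgeCount : ℕ := cycleCount X.rev Set.univ

/-- A planted plane tree with `m` edges: a rooted planar map with a single face. -/
def IsPlaneTree (m : ℕ) : Prop := X.IsPlanarMap ∧ X.faceCount = 1 ∧ X.edgeCount = m

/-- The oriented edges of the boundary: those that have the root face (the external face) on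
their left. -/
def IsBoundary (d : X.Dart) : Prop := SameCycle X.face X.root d

/-- A rooted planar map whose boundary has size `2 * m` and is bridgeless: the walk along
the boundary never uses both orientations of an edge. -/
def IsBridgelessMap (m : ℕ) : Prop :=
  X.IsPlanarMap ∧ {d | X.IsBoundary d}.ncard = 2 * m ∧
    ∀ d, X.IsBoundary d → ¬ X.IsBoundary (X.rev d)

/-- The `i`-th oriented edge of the boundary walk (from the root, external face on the left). -/
def boundary (i : ℕ) : X.Dart := (X.face ^ i) X.root

/-- The `i`-th oriented edge of the contour walk of a tree: the walker starts along the root, keeps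
the tree on the left hand, and hence turns at each vertex into the first edge
in counterclockwise order. -/
def contour (i : ℕ) : X.Dart := ((X.rot * X.rev) ^ i) X.root

/-- Equality of rooted maps: an orientation preserving isomorphism that preserves the root. -/
def Iso (X Y : RotationSystem) : Prop :=
  ∃ e : X.Dart ≃ Y.Dart, (∀ d, e (X.rev d) = Y.rev (e d)) ∧ (∀ d, e (X.rot d) = Y.rot (e d)) ∧
    e X.root = Y.root

theorem iso_equivalence : Equivalence Iso where
  refl X := ⟨Equiv.refl _, fun _ => rfl, fun _ => rfl, rfl⟩
  symm := by
    rintro X Y ⟨e, h1, h2, h3⟩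
    refine ⟨e.symm, fun d => ?_, fun d => ?_, ?_⟩
    · rw [Equiv.symm_apply_eq, h1, Equiv.apply_symm_apply]
    · rw [Equiv.symm_apply_eq, h2, Equiv.apply_symm_apply]
    · rw [Equiv.symm_apply_eq, h3]
  trans := by
    rintro X Y Z ⟨e, h1, h2, h3⟩ ⟨e', h1', h2', h3'⟩
    exact ⟨e.trans e', fun d => by simp [h1, h1'], fun d => by simp [h2, h2'], by simp [h3, h3']⟩

instance isoSetoid : Setoid RotationSystem := ⟨Iso, iso_equivalence⟩

end RotationSystem

/-- Planted plane trees with `m` edges. -/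
def PlaneTree (m : ℕ) : Type 1 := {T : RotationSystem // T.IsPlaneTree m}

/-- Rooted planar maps with a bridgeless boundary of size `2 * m`. -/
def BridgelessMap (m : ℕ) : Type 1 := {M : RotationSystem // M.IsBridgelessMap m}

instance PlaneTree.isoSetoid (m : ℕ) : Setoid (PlaneTree m) := RotationSystem.isoSetoid.comap Subtype.val

instance BridgelessMap.isoSetoid (m : ℕ) : Setoid (BridgelessMap m) := RotationSystem.isoSetoid.comap Subtype.val

/-! ## Bubble-maps decorated by a circuit -/

/-- `a, b, c, d` are distinct and appear in this order along the cycle of `s` through `a`. -/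
def CyclicallyOrdered {A : Type} (s : A → A) (a b c d : A) : Prop :=
  ∃ i j k : ℕ, 0 < i ∧ i < j ∧ j < k ∧ k < Function.minimalPeriod s a ∧
    s^[i] a = b ∧ s^[j] a = c ∧ s^[k] a = d

/-- Around a vertex with counterclockwise order `ζ` of its darts, every dart `d` carries two
strands: `(d, false)` for a path that leaves along `d`, and `(d, true)` for a path that
arrives along the reversal of `d`. Paths are drawn on the right-hand side of the edges, so the
counterclockwise order of the strands is: leaving along `d`, arriving by `d`, leaving
along `ζ d`, and so on. -/
def strandNext {D : Type} (ζ : Equiv.Perm D) : D × Bool → D × Bool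
  | (d, false) => (d, true)
  | (d, true) => (ζ d, false)

/-- A rotation system (several closed surfaces, the bubbles), with identifications between its
vertices, and with a sequence of darts, whose indices are to be read modulo the
length of the sequence. `vert d d'` means that `d` and `d'` start from the same vertex after the
identifications. -/
structure DecoratedBubbles extends RotationSystem where
  vert : Setoid Dart
  circuit : ℕ → Dart

namespace DecoratedBubbles

variable (X : DecoratedBubbles)

/-- The bubbles, that is, the connected components before the identification of vertices. -/
abbrev Bubble : Type := Quotient X.component

abbrev Vertex : Type := Quotient X.vert

/-- A bubble is adjacent to the vertices that it contains. -/
def incidence : SimpleGraph (X.Bubble ⊕ X.Vertex) :=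
  SimpleGraph.fromRel fun x y => ∃ d : X.Dart,
    x = Sum.inl (Quotient.mk X.component d) ∧ y = Sum.inr (Quotient.mk X.vert d)

/-- A bubble-map: a graph embedded in spheres that are glued to each other at vertices, in
a tree-like way. -/
structure IsBubbleMap : Prop where
  /-- The vertices arise by identifying vertices of the bubbles. -/
  vert_rot : ∀ d, X.vert d (X.rot d)
  /-- Every bubble is a sphere. -/
  spherical : ∀ d, X.IsSpherical {d' | X.component d d'}
  /-- Vertices of the same bubble are not identified with each other. -/
  separated : ∀ d d', X.component d d' → X.vert d d' → SameCycle X.rot d d'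
  /-- The bubbles are attached to each other in a tree-like way. -/
  tree : X.incidence.IsTree

/-- The underlying object is a rooted planar map: no vertices are identified, and it is a connected
graph in one sphere. -/
def IsMap : Prop := X.IsPlanarMap ∧ ∀ d d', X.vert d d' ↔ SameCycle X.rot d d'

/-- The vertex from which `d` starts is a pinch point: at least two bubbles meet there. -/
def IsPinched (d : X.Dart) : Prop := ∃ d', X.vert d d' ∧ ¬ SameCycle X.rot d d'

/-- `ζ` lays out in the plane, around every vertex, the bubbles that meet there: it is a cyclic order
of all darts at the vertex, which induces on the darts of each bubble their own cyclic order, and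
in which different bubbles do not interlace. At a vertex that is not a pinch point, `ζ` has
to be the cyclic order of the vertex itself. -/
structure IsLayout (ζ : Equiv.Perm X.Dart) : Prop where
  cycles : ∀ d d', SameCycle ζ d d' ↔ X.vert d d'
  induced : ∀ (d : X.Dart) (n : ℕ), 0 < n → SameCycle X.rot d ((ζ ^ n) d) →
    (∀ k, 0 < k → k < n → ¬ SameCycle X.rot d ((ζ ^ k) d)) → (ζ ^ n) d = X.rot d
  noninterlacing : ∀ a b c d, CyclicallyOrdered ζ a b c d →
    SameCycle X.rot a c → SameCycle X.rot b d → SameCycle X.rot a b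

/-- The circuit does not cross itself: for a suitable layout of the pinch points, one never sees
`e i`, `e (j + 1)`, `e (i + 1)`, `e j` in this cyclic order around a vertex. -/
def NonCrossing : Prop :=
  ∃ ζ, X.IsLayout ζ ∧ ∀ i j, ¬ CyclicallyOrdered (strandNext ζ)
    (X.rev (X.circuit i), true) (X.circuit (j + 1), false)
    (X.circuit (i + 1), false) (X.rev (X.circuit j), true)

/-- A bubble-map decorated by a non-self-crossing circuit of length `2 * m`. -/
structure IsCircuitBubbleMap (m : ℕ) : Prop where
  bubbleMap : X.IsBubbleMap
  /-- The circuit starts with the root. -/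
  start : X.circuit 0 = X.root
  /-- The circuit has length `2 * m`, and uses each oriented edge at most once. -/
  length : ∀ i j, X.circuit i = X.circuit j ↔ i ≡ j [MOD 2 * m]
  /-- Each edge of the circuit is used in both directions. -/
  both : ∀ i, ∃ j, X.circuit j = X.rev (X.circuit i)
  /-- The head of an edge is the tail of the next one. -/
  chain : ∀ i, X.vert (X.rev (X.circuit i)) (X.circuit (i + 1))
  nonCrossing : X.NonCrossing
  /-- At each pinch point, the circuit passes through each of the bubbles that meet there. -/
  pinch : ∀ d, X.IsPinched d → ∃ i, SameCycle X.rot d (X.circuit i)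

/-- Equality of decorated bubble-maps: an isomorphism that preserves the orientation, the root,
the vertices and the circuit. -/
def Iso (X Y : DecoratedBubbles) : Prop :=
  ∃ e : X.Dart ≃ Y.Dart, (∀ d, e (X.rev d) = Y.rev (e d)) ∧ (∀ d, e (X.rot d) = Y.rot (e d)) ∧
    e X.root = Y.root ∧ (∀ d d', X.vert d d' ↔ Y.vert (e d) (e d')) ∧
    ∀ i, e (X.circuit i) = Y.circuit i

theorem iso_equivalence : Equivalence Iso where
  refl X := ⟨Equiv.refl _, fun _ => rfl, fun _ => rfl, rfl, fun _ _ => Iff.rfl, fun _ => rfl⟩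
  symm := by
    rintro X Y ⟨e, h1, h2, h3, h4, h5⟩
    refine ⟨e.symm, fun d => ?_, fun d => ?_, ?_, fun d d' => ?_, fun i => ?_⟩
    · rw [Equiv.symm_apply_eq, h1, Equiv.apply_symm_apply]
    · rw [Equiv.symm_apply_eq, h2, Equiv.apply_symm_apply]
    · rw [Equiv.symm_apply_eq, h3]
    · rw [h4, Equiv.apply_symm_apply, Equiv.apply_symm_apply]
    · rw [Equiv.symm_apply_eq, h5]
  trans := by
    rintro X Y Z ⟨e, h1, h2, h3, h4, h5⟩ ⟨e', h1', h2', h3', h4', h5'⟩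
    exact ⟨e.trans e', fun d => by simp [h1, h1'], fun d => by simp [h2, h2'], by simp [h3, h3'],
      fun d d' => by simp [h4, h4'], fun i => by simp [h5, h5']⟩

instance isoSetoid : Setoid DecoratedBubbles := ⟨Iso, iso_equivalence⟩

end DecoratedBubbles

/-! ## The gluing -/

section CycleFacts

variable {D : Type} [Finite D] (p : Equiv.Perm D) (x : D)

theorem exists_pow_lt_of_sameCycle {y : D} (h : SameCycle p x y) :
    ∃ n < Function.minimalPeriod p x, (p ^ n) x = y := by
  obtain ⟨n, hn⟩ := h.exists_nat_pow_eq
  have hpos : 0 < Function.minimalPeriod p x :=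
    Function.minimalPeriod_pos_of_mem_periodicPts
      (Function.Injective.mem_periodicPts p.injective x)
  refine ⟨n % Function.minimalPeriod p x, Nat.mod_lt _ hpos, ?_⟩
  rw [← hn, ← Equiv.Perm.iterate_eq_pow, ← Equiv.Perm.iterate_eq_pow,
    Function.iterate_mod_minimalPeriod_eq]

theorem ncard_sameCycle : {y | SameCycle p x y}.ncard = Function.minimalPeriod p x := by
  have : {y | SameCycle p x y} =
      (fun n : ℕ => (p ^ n) x) '' (Finset.range (Function.minimalPeriod p x) : Set ℕ) := by
    ext y
    constructor
    · intro h
      obtain ⟨n, hn, h⟩ := exists_pow_lt_of_sameCycle p x h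
      exact ⟨n, by simpa using hn, h⟩
    · rintro ⟨n, -, rfl⟩
      exact ⟨n, by simp⟩
  rw [this, Set.InjOn.ncard_image, Set.ncard_coe_finset, Finset.card_range]
  intro a ha b hb hab
  simp only [Finset.coe_range, Set.mem_Iio] at ha hb
  simp only [← Equiv.Perm.iterate_eq_pow] at hab
  exact (Function.iterate_eq_iterate_iff_of_lt_minimalPeriod ha hb).1 hab

theorem pow_apply_eq_iff {L : ℕ} (h : {y | SameCycle p x y}.ncard = L) (i j : ℕ) :
    (p ^ i) x = (p ^ j) x ↔ i ≡ j [MOD L] := by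
  rw [ncard_sameCycle] at h
  subst h
  have hpos : 0 < Function.minimalPeriod p x :=
    Function.minimalPeriod_pos_of_mem_periodicPts
      (Function.Injective.mem_periodicPts p.injective x)
  rw [← Equiv.Perm.iterate_eq_pow, ← Equiv.Perm.iterate_eq_pow,
    ← Function.iterate_mod_minimalPeriod_eq (n := i), ← Function.iterate_mod_minimalPeriod_eq (n := j),
    Function.iterate_eq_iterate_iff_of_lt_minimalPeriod (Nat.mod_lt _ hpos) (Nat.mod_lt _ hpos)]
  rfl

end CycleFacts

namespace BridgelessMap

variable {m : ℕ} (M : BridgelessMap m)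

theorem boundary_eq_iff (i j : ℕ) :
    M.1.boundary i = M.1.boundary j ↔ i ≡ j [MOD 2 * m] :=
  pow_apply_eq_iff M.1.face M.1.root M.2.2.1 i j

theorem isBoundary_boundary (i : ℕ) : M.1.IsBoundary (M.1.boundary i) := ⟨i, by
  simp [RotationSystem.boundary]⟩

theorem exists_boundary {d : M.1.Dart} (h : M.1.IsBoundary d) : ∃ i, M.1.boundary i = d :=
  let ⟨i, _, hi⟩ := exists_pow_lt_of_sameCycle _ _ h
  ⟨i, hi⟩

/-- The oriented edges that have an internal face on their left. -/
abbrev InnerDart : Type := {d : M.1.Dart // ¬ M.1.IsBoundary d}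

/-- The reversal of a boundary edge. -/
def revBoundary (i : ℕ) : M.InnerDart :=
  ⟨M.1.rev (M.1.boundary i), M.2.2.2 _ (M.isBoundary_boundary i)⟩

theorem revBoundary_eq_iff (i j : ℕ) :
    M.revBoundary i = M.revBoundary j ↔ i ≡ j [MOD 2 * m] := by
  rw [← M.boundary_eq_iff]
  simp [revBoundary]

/-- The internal faces. -/
def innerFace : Equiv.Perm M.InnerDart :=
  M.1.face.subtypePerm fun d => by
    simp [RotationSystem.IsBoundary]

end BridgelessMap

theorem RotationSystem.card_dart (X : RotationSystem) : Nat.card X.Dart = 2 * X.edgeCount := by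
  classical
  have hfin : Finite (Quotient (SameCycle.setoid X.rev)) := inferInstance
  let π : X.Dart → Quotient (SameCycle.setoid X.rev) := Quotient.mk _
  have hs : ∀ a b : X.Dart, π a = π b ↔ b = a ∨ b = X.rev a := by
    intro a b
    have h2 : X.rev ^ 2 = 1 := by ext d; simp [pow_two, X.rev_rev]
    constructor
    · intro h
      obtain ⟨n, hn⟩ := (Quotient.exact h : SameCycle X.rev a b)
      rcases Int.even_or_odd' n with ⟨k, rfl | rfl⟩
      · left; rw [← hn, zpow_mul]; norm_cast; simp [h2]
      · right; rw [← hn, zpow_add, zpow_mul]; norm_cast; simp [h2]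
    · rintro (rfl | rfl)
      · rfl
      · exact Quotient.sound (⟨1, by simp⟩ : SameCycle X.rev a (X.rev a))
  have e : X.Dart ≃ Quotient (SameCycle.setoid X.rev) × Bool := by
    refine Equiv.ofBijective (fun d => (π d, decide (Quotient.out (π d) = d))) ⟨?_, ?_⟩
    · intro a b hab
      simp only [Prod.mk.injEq] at hab
      obtain ⟨h1, h3⟩ := hab
      rw [← h1] at h3
      have h3' : (Quotient.out (π a) = a) ↔ (Quotient.out (π a) = b) := by simpa using h3
      rcases (hs a b).1 h1 with h | h
      · exact h.symm
      · have ho : π a = π (Quotient.out (π a)) := (Quotient.out_eq (π a)).symm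
        rcases (hs _ _).1 ho with h4 | h4
        · exact h4.symm.trans (h3'.1 h4)
        · rw [h4, h] at h3'
          exact absurd (h3'.2 rfl) (X.rev_ne a)
    · rintro ⟨q, b⟩
      have hq : π (Quotient.out q) = q := Quotient.out_eq q
      cases b
      · refine ⟨X.rev (Quotient.out q), ?_⟩
        have : π (X.rev (Quotient.out q)) = q := by
          rw [← hq, hs]; right; rw [X.rev_rev, hq]
        simp only [this, Prod.mk.injEq, decide_eq_false_iff_not, true_and]
        exact fun h => X.rev_ne _ h.symm
      · exact ⟨Quotient.out q, by simp [hq]⟩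
  have : Set.range π = Set.univ := Set.range_eq_univ.2 Quotient.exists_rep
  rw [Nat.card_congr e, Nat.card_prod, RotationSystem.edgeCount, cycleCount, Set.image_univ]
  change _ = 2 * (Set.range π).ncard
  rw [this, Set.ncard_univ]
  simp [mul_comm]

namespace PlaneTree

variable {m : ℕ} (T : PlaneTree m)

theorem sameCycle_contour (d : T.1.Dart) : SameCycle (T.1.rot * T.1.rev) T.1.root d := by
  have hface : ∀ a b : T.1.Dart, SameCycle T.1.face a b := by
    intro a b
    have h := T.2.2.1
    rw [RotationSystem.faceCount, cycleCount, Set.ncard_eq_one] at h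
    obtain ⟨q, hq⟩ := h
    have ha : Quotient.mk (SameCycle.setoid T.1.face) a = q := by
      have := hq ▸ Set.mem_image_of_mem (Quotient.mk (SameCycle.setoid T.1.face)) (Set.mem_univ a)
      simpa using this
    have hb : Quotient.mk (SameCycle.setoid T.1.face) b = q := by
      have := hq ▸ Set.mem_image_of_mem (Quotient.mk (SameCycle.setoid T.1.face)) (Set.mem_univ b)
      simpa using this
    exact Quotient.exact (ha.trans hb.symm)
  have hrr : T.1.rev⁻¹ = T.1.rev := by
    ext d; rw [Equiv.Perm.inv_eq_iff_eq, T.1.rev_rev]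
  have hconj : T.1.rot * T.1.rev = T.1.rev * T.1.face⁻¹ * T.1.rev⁻¹ := by
    simp only [RotationSystem.face, mul_inv_rev, inv_inv, hrr]
    ext d
    simp [T.1.rev_rev]
  rw [hconj, sameCycle_conj, sameCycle_inv]
  exact hface _ _

theorem exists_contour (d : T.1.Dart) : ∃ i, T.1.contour i = d :=
  let ⟨i, _, hi⟩ := exists_pow_lt_of_sameCycle _ _ (T.sameCycle_contour d)
  ⟨i, hi⟩

theorem contour_eq_iff (i j : ℕ) : T.1.contour i = T.1.contour j ↔ i ≡ j [MOD 2 * m] := by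
  refine pow_apply_eq_iff (T.1.rot * T.1.rev) T.1.root ?_ i j
  have : {y | SameCycle (T.1.rot * T.1.rev) T.1.root y} = Set.univ :=
    Set.eq_univ_of_forall T.sameCycle_contour
  rw [this, Set.ncard_univ, T.1.card_dart, T.2.2.2]

/-- A time at which the contour walk uses the edge of step `i` in the other direction. -/
noncomputable def mate (i : ℕ) : ℕ := (T.exists_contour (T.1.rev (T.1.contour i))).choose

theorem contour_mate (i : ℕ) : T.1.contour (T.mate i) = T.1.rev (T.1.contour i) :=
  (T.exists_contour (T.1.rev (T.1.contour i))).choose_spec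

theorem mate_modEq {i j : ℕ} (h : i ≡ j [MOD 2 * m]) : T.mate i ≡ T.mate j [MOD 2 * m] := by
  rw [← T.contour_eq_iff, contour_mate, contour_mate, (T.contour_eq_iff i j).2 h]

theorem mate_mate (i : ℕ) : T.mate (T.mate i) ≡ i [MOD 2 * m] := by
  rw [← T.contour_eq_iff, contour_mate, contour_mate, T.1.rev_rev]

theorem not_mate_modEq (i : ℕ) : ¬ T.mate i ≡ i [MOD 2 * m] := by
  rw [← T.contour_eq_iff, contour_mate]
  exact T.1.rev_ne _

end PlaneTree

section Gluing

variable {m : ℕ} (T : PlaneTree m) (M : BridgelessMap m)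

open Classical in
/-- The reversal of darts after the gluing: the `i`-th and the `j`-th edge of the boundary
are identified with each other, with opposite orientations, when the steps `i` and `j` of the contour
walk use the same edge of the tree. The other edges are kept. -/
noncomputable def glueRevFun (d : M.InnerDart) : M.InnerDart :=
  if h : M.1.IsBoundary (M.1.rev d.1) then
    M.revBoundary (T.mate (M.exists_boundary h).choose)
  else ⟨M.1.rev d.1, h⟩

theorem glueRevFun_revBoundary (i : ℕ) :
    glueRevFun T M (M.revBoundary i) = M.revBoundary (T.mate i) := by
  have h : M.1.IsBoundary (M.1.rev (M.revBoundary i).1) := by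
    simp only [BridgelessMap.revBoundary, M.1.rev_rev]
    exact M.isBoundary_boundary i
  rw [glueRevFun, dif_pos h, M.revBoundary_eq_iff]
  apply T.mate_modEq
  rw [← M.boundary_eq_iff, (M.exists_boundary h).choose_spec]
  simp [BridgelessMap.revBoundary, M.1.rev_rev]

theorem glueRevFun_of_not {d : M.InnerDart} (h : ¬ M.1.IsBoundary (M.1.rev d.1)) :
    glueRevFun T M d = ⟨M.1.rev d.1, h⟩ := dif_neg h

theorem BridgelessMap.exists_revBoundary {d : M.InnerDart} (h : M.1.IsBoundary (M.1.rev d.1)) :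
    ∃ i, d = M.revBoundary i := by
  obtain ⟨i, hi⟩ := M.exists_boundary h
  exact ⟨i, Subtype.ext (by simp [BridgelessMap.revBoundary, hi, M.1.rev_rev])⟩

theorem glueRevFun_involutive : Function.Involutive (glueRevFun T M) := by
  intro d
  by_cases h : M.1.IsBoundary (M.1.rev d.1)
  · obtain ⟨i, rfl⟩ := M.exists_revBoundary h
    rw [glueRevFun_revBoundary, glueRevFun_revBoundary, M.revBoundary_eq_iff]
    exact T.mate_mate i
  · have h' : ¬ M.1.IsBoundary (M.1.rev (M.1.rev d.1)) := by rw [M.1.rev_rev]; exact d.2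
    rw [glueRevFun_of_not T M h, glueRevFun_of_not T M (d := ⟨M.1.rev d.1, h⟩) h']
    exact Subtype.ext (M.1.rev_rev _)

theorem glueRevFun_ne (d : M.InnerDart) : glueRevFun T M d ≠ d := by
  by_cases h : M.1.IsBoundary (M.1.rev d.1)
  · obtain ⟨i, rfl⟩ := M.exists_revBoundary h
    rw [glueRevFun_revBoundary, Ne, M.revBoundary_eq_iff]
    exact T.not_mate_modEq i
  · rw [glueRevFun_of_not T M h]
    exact fun h' => M.1.rev_ne _ (congrArg Subtype.val h')

noncomputable def glueRev : Equiv.Perm M.InnerDart := (glueRevFun_involutive T M).toPerm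

/-- The one-step identifications of starting points: `x` and `y` start from the same vertex of the map,
or they are the `i`-th and `j`-th edges of the boundary, and the contour walk of the tree is at the
same vertex of the tree before its steps `i` and `j`. -/
def TailIdentified (x y : M.1.Dart) : Prop :=
  SameCycle M.1.rot x y ∨ ∃ i j, x = M.1.boundary i ∧ y = M.1.boundary j ∧
    SameCycle T.1.rot (T.1.contour i) (T.1.contour j)

/-- The gluing of the tree `T` into the external face of `M`. The external face disappears, the internal
faces are kept, and the boundary edges and boundary vertices are identified according to the contour
walk of `T`. The circuit is the image of the contour walk: its `i`-th step is the image of the `i`-th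
boundary edge, which is identified with the reversal of its mate; the root is the image of
the root. The rotation is the one for which the faces are the internal faces of `M`. -/
noncomputable def glue : DecoratedBubbles where
  Dart := M.InnerDart
  finite_dart := inferInstance
  rev := glueRev T M
  rot := glueRev T M * M.innerFace⁻¹
  rev_rev := glueRevFun_involutive T M
  rev_ne := glueRevFun_ne T M
  root := M.revBoundary (T.mate 0)
  vert := (Relation.EqvGen.setoid (TailIdentified T M)).comap Subtype.val
  circuit i := M.revBoundary (T.mate i)

end Gluing

/-- Isomorphic trees and isomorphic maps give isomorphic gluings. -/
theorem glue_iso {m : ℕ} {T T' : PlaneTree m} {M M' : BridgelessMap m}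
    (hT : RotationSystem.Iso T.1 T'.1) (hM : RotationSystem.Iso M.1 M'.1) :
    DecoratedBubbles.Iso (glue T M) (glue T' M') := by
  have tail : ∀ {T T' : PlaneTree m} {M M' : BridgelessMap m} (eT : T.1.Dart ≃ T'.1.Dart)
      (eM : M.1.Dart ≃ M'.1.Dart),
      (∀ d, eT (T.1.rot d) = T'.1.rot (eT d)) → (∀ i, eT (T.1.contour i) = T'.1.contour i) →
      (∀ d, eM (M.1.rot d) = M'.1.rot (eM d)) → (∀ i, eM (M.1.boundary i) = M'.1.boundary i) →
      ∀ x y, Relation.EqvGen (TailIdentified T M) x y →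
        Relation.EqvGen (TailIdentified T' M') (eM x) (eM y) := by
    intro T T' M M' eT eM hT hc hM hb
    have key : ∀ {X Y : RotationSystem} (e : X.Dart ≃ Y.Dart),
        (∀ d, e (X.rot d) = Y.rot (e d)) → ∀ x y, SameCycle X.rot x y →
          SameCycle Y.rot (e x) (e y) := by
      intro X Y e h x y hxy
      obtain ⟨n, rfl⟩ := hxy.exists_nat_pow_eq
      refine ⟨n, ?_⟩
      rw [zpow_natCast]
      induction n with
      | zero => rfl
      | succ n ih => rw [pow_succ', pow_succ', mul_apply, mul_apply, ih ⟨n, rfl⟩, h]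
    intro x y h
    induction h with
    | rel x y h =>
      apply Relation.EqvGen.rel
      rcases h with h | ⟨i, j, rfl, rfl, h⟩
      · exact Or.inl (key eM hM _ _ h)
      · refine Or.inr ⟨i, j, hb i, hb j, ?_⟩
        have := key eT hT _ _ h
        rwa [hc, hc] at this
    | refl x => exact Relation.EqvGen.refl _
    | symm x y _ ih => exact Relation.EqvGen.symm _ _ ih
    | trans x y z _ _ ih1 ih2 => exact Relation.EqvGen.trans _ _ _ ih1 ih2
  obtain ⟨eT, ht1, ht2, ht3⟩ := hT
  obtain ⟨eM, hm1, hm2, hm3⟩ := hM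
  have hc : ∀ i, eT (T.1.contour i) = T'.1.contour i := by
    intro i
    induction i with
    | zero => exact ht3
    | succ n ih =>
      simp only [RotationSystem.contour, pow_succ', mul_apply] at ih ⊢
      rw [ht2, ht1, ih]
  have hface : ∀ d, eM (M.1.face d) = M'.1.face (eM d) := by
    intro d
    simp only [RotationSystem.face, mul_apply]
    rw [Equiv.Perm.eq_inv_iff_eq, ← hm2, ← hm1]
    simp
  have hb : ∀ i, eM (M.1.boundary i) = M'.1.boundary i := by
    intro i
    induction i with
    | zero => exact hm3
    | succ n ih =>
      simp only [RotationSystem.boundary, pow_succ', mul_apply] at ih ⊢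
      rw [hface, ih]
  have hB : ∀ d, M.1.IsBoundary d ↔ M'.1.IsBoundary (eM d) := by
    intro d
    constructor
    · intro h
      obtain ⟨i, rfl⟩ := M.exists_boundary h
      rw [hb]
      exact M'.isBoundary_boundary i
    · intro h
      obtain ⟨i, hi⟩ := M'.exists_boundary h
      rw [← hb] at hi
      rw [← eM.injective hi]
      exact M.isBoundary_boundary i
  have hmate : ∀ i, T.mate i ≡ T'.mate i [MOD 2 * m] := by
    intro i
    rw [← T'.contour_eq_iff, T'.contour_mate, ← hc, T.contour_mate, ht1, hc]
  let e : M.InnerDart ≃ M'.InnerDart := eM.subtypeEquiv fun d => not_congr (hB d)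
  have hrb : ∀ i, e (M.revBoundary i) = M'.revBoundary i := by
    intro i
    apply Subtype.ext
    simp only [e, BridgelessMap.revBoundary, Equiv.subtypeEquiv_apply]
    rw [hm1, hb]
  have hcirc : ∀ i, e (M.revBoundary (T.mate i)) = M'.revBoundary (T'.mate i) := by
    intro i
    rw [hrb, M'.revBoundary_eq_iff]
    exact hmate i
  have hrev : ∀ d, e (glueRevFun T M d) = glueRevFun T' M' (e d) := by
    intro d
    by_cases h : M.1.IsBoundary (M.1.rev d.1)
    · obtain ⟨i, rfl⟩ := M.exists_revBoundary h
      rw [glueRevFun_revBoundary, hrb i, glueRevFun_revBoundary, hcirc]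
    · have h' : ¬ M'.1.IsBoundary (M'.1.rev (e d).1) := by
        simp only [e, Equiv.subtypeEquiv_apply]
        rw [← hm1, ← hB]
        exact h
      rw [glueRevFun_of_not T M h, glueRevFun_of_not T' M' h']
      exact Subtype.ext (hm1 _)
  have hinner : ∀ d, e (M.innerFace d) = M'.innerFace (e d) := fun d => Subtype.ext (hface _)
  refine ⟨e, hrev, fun d => ?_, hcirc 0, fun d d' => ⟨?_, fun h => ?_⟩, hcirc⟩
  · change e (glueRevFun T M (M.innerFace⁻¹ d)) = glueRevFun T' M' (M'.innerFace⁻¹ (e d))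
    rw [hrev]
    congr 1
    rw [Equiv.Perm.eq_inv_iff_eq, ← hinner]
    exact congrArg e (M.innerFace.apply_symm_apply d)
  · exact tail eT eM ht2 hc hm2 hb d.1 d'.1
  · have := tail eT.symm eM.symm
      (fun d => by rw [Equiv.symm_apply_eq, ht2, Equiv.apply_symm_apply])
      (fun i => by rw [Equiv.symm_apply_eq, hc])
      (fun d => by rw [Equiv.symm_apply_eq, hm2, Equiv.apply_symm_apply])
      (fun i => by rw [Equiv.symm_apply_eq, hb]) (e d).1 (e d').1 h
    change Relation.EqvGen (TailIdentified T M) (eM.symm (eM d.1)) (eM.symm (eM d'.1)) at this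
    rw [Equiv.symm_apply_apply, Equiv.symm_apply_apply] at this
    exact this

/-- The gluing, on isomorphism classes. -/
noncomputable def gluing (m : ℕ) :
    Quotient (PlaneTree.isoSetoid m) ×
      Quotient (BridgelessMap.isoSetoid m) →
    Quotient DecoratedBubbles.isoSetoid :=
  fun p => Quotient.map₂ glue (fun _ _ hT _ _ hM => glue_iso hT hM) p.1 p.2

/-- Maps with a bridgeless boundary of size `2 * m` and with `f` internal faces,
up to isomorphism. -/
def boundaryMapsByFaces (f m : ℕ) : Set (Quotient (BridgelessMap.isoSetoid m)) :=
  {q | ∃ M : BridgelessMap m, Quotient.mk _ M = q ∧ M.1.faceCount = f + 1}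

/-- Maps with a bridgeless boundary of size `2 * m` and with `e` edges that do not belong to
the boundary, up to isomorphism. -/
def boundaryMapsByEdges (e m : ℕ) : Set (Quotient (BridgelessMap.isoSetoid m)) :=
  {q | ∃ M : BridgelessMap m, Quotient.mk _ M = q ∧
    cycleCount M.1.rev {d | ¬ M.1.IsBoundary d ∧ ¬ M.1.IsBoundary (M.1.rev d)} = e}

/-- Bubble-maps with `f` faces decorated by a non-self-crossing circuit of length `2 * m`,
up to isomorphism. -/
def circuitBubbleMapsByFaces (f m : ℕ) : Set (Quotient DecoratedBubbles.isoSetoid) :=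
  {q | ∃ X : DecoratedBubbles, Quotient.mk _ X = q ∧ X.IsCircuitBubbleMap m ∧ X.faceCount = f}

/-- Bubble-maps with `n` edges decorated by a non-self-crossing circuit of length `2 * m`,
up to isomorphism. -/
def circuitBubbleMapsByEdges (n m : ℕ) : Set (Quotient DecoratedBubbles.isoSetoid) :=
  {q | ∃ X : DecoratedBubbles, Quotient.mk _ X = q ∧ X.IsCircuitBubbleMap m ∧ X.edgeCount = n}

/-! Let `X` be a bubble-map with circuit e_0, e_1, ..., let D be its set of darts, ρ = `X.rot`, and
let τ = `turn` be the permutation of D that sends the reversal of e_i to e_{i+1} and fixes all other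
darts. Without any planarity one can form the tree of the circuit, whose vertices are the cycles of
τ on the circuit, and the cut map, which has one extra dart per step, all of them around one new
face, and whose vertices correspond to the cycles of τ⁻¹ρ. Applied to a gluing, these return T and M
(`exists_equiv_tree_glue`, `exists_equiv_cut_glue`); conversely `X` is the gluing of its tree and
its cut map once both are planar and the vertices of `X` are the joint orbits of ρ and τ
(`glue_vert`, `IsCircuit.iso_glue`). It remains to see that these conditions characterise the
decorated bubble-maps.

Both implications come from chains of inequalities without slack. Write c for numbers of cycles and
|r| for the number of classes of r. If the tree and the cut map are planar, then c(τ) and c(τ⁻¹ρ)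
are known. The genus inequality c(ρ) + c(τ) + c(τ⁻¹ρ) ≤ |D| + 2|vert|, Euler's inequality for the
bubbles, and semimodularity |component| + |vert| ≤ |component ⊓ vert| + 1 must then all be
equalities (`IsCircuit.tight`). So the bubbles are spheres attached in a tree-like way, and ρ, τ
have genus zero, which yields a layout in which the circuit does not cross itself. Conversely, a
noncrossing layout bounds c(τ) + c(τ⁻¹ρ) from below, Euler's inequalities for the tree and the cut
map bound it from above, and the bounds agree (`IsCircuitBubbleMap.planarity`).

The bridge between pictures and numbers: α is noncrossing inside the cycles of ζ if and only if its
cycles lie in those of ζ and c(α) + c(α⁻¹ζ) = |D| + c(ζ) (`IsNoncrossing.cycleNumber_add`,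
`isNoncrossing_of_cycleNumber_add`), and a pair of genus zero is noncrossing in a common ζ
(`exists_layout_of_genus_zero`).

For the first claim, if there is no pinch point then the same equalities force a cycle of τ and a
cycle of τ⁻¹ρ, that is a vertex of T and a vertex of M, to share at most one dart. -/

/-! ## Counting classes of equivalence relations and cycles of permutations -/

namespace Setoid

variable {D : Type}

/-- The number of classes of an equivalence relation. -/
noncomputable def classCount (r : Setoid D) : ℕ := Nat.card (Quotient r)

/-- The rational functions that are constant on the classes of `r`. -/
def invariantFunctions (r : Setoid D) : Submodule ℚ (D → ℚ) where
  carrier := {f | ∀ x y, r x y → f x = f y}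
  add_mem' hf hg x y h := by simp [hf x y h, hg x y h]
  zero_mem' _ _ _ := rfl
  smul_mem' c f hf x y h := by simp [hf x y h]

theorem mem_invariantFunctions {r : Setoid D} {f : D → ℚ} :
    f ∈ r.invariantFunctions ↔ r ≤ Setoid.ker f := Iff.rfl

theorem invariantFunctions_sup (r s : Setoid D) :
    (r ⊔ s).invariantFunctions = r.invariantFunctions ⊓ s.invariantFunctions := by
  ext f
  simp only [Submodule.mem_inf, mem_invariantFunctions, sup_le_iff]

theorem invariantFunctions_anti {r s : Setoid D} (h : r ≤ s) :
    s.invariantFunctions ≤ r.invariantFunctions :=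
  fun _ hf x y hxy => hf x y (h hxy)

theorem classCount_bot : (⊥ : Setoid D).classCount = Nat.card D :=
  (Nat.card_congr (Equiv.ofBijective (Quotient.mk (⊥ : Setoid D))
    ⟨fun _ _ h => Quotient.exact h, Quotient.mk_surjective⟩)).symm

theorem classCount_top [Nonempty D] : (⊤ : Setoid D).classCount = 1 := by
  rw [classCount, Nat.card_eq_one_iff_unique]
  exact ⟨⟨by rintro ⟨x⟩ ⟨y⟩; exact Quotient.sound trivial⟩, ⟨Quotient.mk _ (Classical.arbitrary D)⟩⟩

/-- A relation on `D` and a relation on `E` that are pulled back from each other along a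
map that meets every class have the same number of classes. -/
theorem classCount_eq_of_map {E : Type} {r : Setoid D} {s : Setoid E} (f : D → E)
    (hf : ∀ x y, r x y ↔ s (f x) (f y)) (hs : ∀ z, ∃ x, s (f x) z) :
    r.classCount = s.classCount :=
  Nat.card_congr (Equiv.ofBijective (Quotient.map f fun x y => (hf x y).1) ⟨by
    rintro ⟨x⟩ ⟨y⟩ h
    exact Quotient.sound ((hf x y).2 (Quotient.exact h)), by
    rintro ⟨z⟩
    obtain ⟨x, hx⟩ := hs z
    exact ⟨Quotient.mk r x, Quotient.sound hx⟩⟩)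

variable [Finite D]

theorem finrank_invariantFunctions (r : Setoid D) :
    Module.finrank ℚ r.invariantFunctions = r.classCount := by
  have e : r.invariantFunctions ≃ₗ[ℚ] (Quotient r → ℚ) :=
    { toFun := fun f => Quotient.lift f.1 f.2
      invFun := fun g => ⟨fun x => g (Quotient.mk r x), fun x y h => congrArg g (Quotient.sound h)⟩
      map_add' := fun f g => by
        ext q; induction q using Quotient.inductionOn; rfl
      map_smul' := fun c f => by
        ext q; induction q using Quotient.inductionOn; rfl
      left_inv := fun f => rfl
      right_inv := fun g => by
        ext q; induction q using Quotient.inductionOn; rfl }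
  have := Fintype.ofFinite (Quotient r)
  rw [e.finrank_eq, Module.finrank_fintype_fun_eq_card, classCount, Nat.card_eq_fintype_card]

theorem classCount_le_of_le {r s : Setoid D} (h : r ≤ s) : s.classCount ≤ r.classCount :=
  Nat.card_le_card_of_surjective (Quotient.map id h) (by
    rintro ⟨x⟩; exact ⟨Quotient.mk r x, rfl⟩)

theorem eq_of_le_of_classCount_le {r s : Setoid D} (h : r ≤ s) (hc : r.classCount ≤ s.classCount) :
    r = s := by
  have hs : Function.Surjective (Quotient.map id h : Quotient r → Quotient s) := by
    rintro ⟨x⟩; exact ⟨Quotient.mk r x, rfl⟩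
  have hb := (Nat.bijective_iff_surjective_and_card _).2
    ⟨hs, le_antisymm hc (classCount_le_of_le h)⟩
  refine le_antisymm h fun {x y} hxy => ?_
  have : Quotient.map id h (Quotient.mk r x) = Quotient.map id h (Quotient.mk r y) :=
    Quotient.sound hxy
  exact Quotient.exact (hb.1 this)

theorem classCount_lt_of_le {r s : Setoid D} (h : r ≤ s) {x y : D} (hs : s x y) (hr : ¬ r x y) :
    s.classCount < r.classCount := by
  refine lt_of_not_ge fun hc => hr ?_
  rw [eq_of_le_of_classCount_le h hc]
  exact hs

theorem eq_top_of_classCount_le_one {r : Setoid D} (h : r.classCount ≤ 1) : r = ⊤ := by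
  have := Finite.card_le_one_iff_subsingleton.1 h
  exact le_antisymm le_top fun {x y} _ => Quotient.exact (Subsingleton.elim (Quotient.mk r x) _)

theorem classCount_le_card (r : Setoid D) : r.classCount ≤ Nat.card D := by
  rw [← classCount_bot]
  exact classCount_le_of_le bot_le

/-- Semimodularity of the partition lattice, read off from dimensions: the functions invariant under
`r ⊔ s` are the intersection of the two spaces, while the sum of the two spaces is only contained in
the functions invariant under `r ⊓ s`. -/
theorem classCount_add_le (r s : Setoid D) :
    r.classCount + s.classCount ≤ (r ⊓ s).classCount + (r ⊔ s).classCount := by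
  rw [← finrank_invariantFunctions r, ← finrank_invariantFunctions s,
    ← finrank_invariantFunctions (r ⊓ s), ← finrank_invariantFunctions (r ⊔ s),
    ← Submodule.finrank_sup_add_finrank_inf_eq, invariantFunctions_sup]
  gcongr
  exact Submodule.finrank_mono (sup_le (invariantFunctions_anti inf_le_left)
    (invariantFunctions_anti inf_le_right))

open Classical in
/-- Identifying one more pair decreases the number of classes by at most one. -/
theorem classCount_le_succ {r t : Setoid D} (x y : D)
    (h : ∀ u : Setoid D, r ≤ u → u x y → t ≤ u) : r.classCount ≤ t.classCount + 1 := by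
  -- `g` redirects the class of `y` to the class of `x`, hence is constant on the classes of `t`.
  -- The only class of `r` it may miss is that of `y`, which `none` supplies below.
  let g : D → Quotient r := fun a => if r a y then Quotient.mk r x else Quotient.mk r a
  have hg : t ≤ Setoid.ker g := by
    apply h
    · intro a b hab
      have : r a y ↔ r b y := ⟨fun h => r.trans' (r.symm' hab) h, fun h => r.trans' hab h⟩
      simp only [Setoid.ker_def, g, this]
      split_ifs
      · rfl
      · exact Quotient.sound hab
    · simp [Setoid.ker_def, g]
  have hsurj : Function.Surjective (fun o : Option (Quotient t) =>
      o.elim (Quotient.mk r y) (Quotient.lift g hg)) := by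
    rintro ⟨a⟩
    by_cases ha : r a y
    · exact ⟨none, Quotient.sound (r.symm' ha)⟩
    · exact ⟨some (Quotient.mk t a), by change g a = _; simp only [g, ha]; rfl⟩
  calc r.classCount ≤ Nat.card (Option (Quotient t)) := Nat.card_le_card_of_surjective _ hsurj
    _ = _ := Finite.card_option

end Setoid

/-! ### Cycle numbers, transpositions and the genus inequality. -/

namespace Equiv.Perm

variable {D : Type}

theorem setoid_le_iff {p : Perm D} {u : Setoid D} :
    SameCycle.setoid p ≤ u ↔ ∀ x, u x (p x) := by
  constructor
  · exact fun h x => h (⟨1, by simp⟩ : SameCycle p x (p x))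
  · intro h x y hxy
    obtain ⟨n, rfl⟩ : SameCycle p x y := hxy
    induction n using Int.induction_on with
    | zero => exact u.refl' x
    | succ n ih =>
      have := h ((p ^ (n : ℤ)) x)
      rw [← mul_apply, ← zpow_one_add, add_comm] at this
      exact u.trans' ih this
    | pred n ih =>
      have := h ((p ^ (-(n : ℤ) - 1)) x)
      rw [← mul_apply, ← zpow_one_add, add_sub_cancel] at this
      exact u.trans' ih (u.symm' this)

theorem setoid_inv (p : Perm D) : SameCycle.setoid p⁻¹ = SameCycle.setoid p := by
  ext x y; exact sameCycle_inv

theorem setoid_mul_le {p q : Perm D} {u : Setoid D} (hp : SameCycle.setoid p ≤ u)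
    (hq : SameCycle.setoid q ≤ u) : SameCycle.setoid (p * q) ≤ u :=
  setoid_le_iff.2 fun x => u.trans' (setoid_le_iff.1 hq x) (setoid_le_iff.1 hp (q x))

theorem setoid_inv_mul_le {p q : Perm D} {u : Setoid D} (hp : SameCycle.setoid p ≤ u)
    (hq : SameCycle.setoid q ≤ u) : SameCycle.setoid (p⁻¹ * q) ≤ u :=
  setoid_mul_le (by rwa [setoid_inv]) hq

theorem setoid_sup_inv_mul (p q : Perm D) :
    SameCycle.setoid p ⊔ SameCycle.setoid (p⁻¹ * q) = SameCycle.setoid p ⊔ SameCycle.setoid q := by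
  refine le_antisymm (sup_le le_sup_left (setoid_inv_mul_le le_sup_left le_sup_right))
    (sup_le le_sup_left ?_)
  conv_lhs => rw [← mul_inv_cancel_left p q]
  exact setoid_mul_le le_sup_left le_sup_right

/-- The number of cycles of a permutation, fixed points included. -/
noncomputable def cycleNumber (p : Perm D) : ℕ := (SameCycle.setoid p).classCount

theorem cycleCount_univ (p : Perm D) : cycleCount p _root_.Set.univ = cycleNumber p := by
  rw [cycleCount, Set.image_univ, Set.range_eq_univ.2 (@Quotient.mk_surjective _ (SameCycle.setoid p)),
    Set.ncard_univ]
  rfl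

theorem cycleNumber_inv (p : Perm D) : cycleNumber p⁻¹ = cycleNumber p := by
  rw [cycleNumber, setoid_inv]; rfl

theorem cycleNumber_one : cycleNumber (1 : Perm D) = Nat.card D := by
  rw [← Setoid.classCount_bot, cycleNumber]
  congr 1
  exact le_antisymm (setoid_le_iff.2 fun x => rfl) bot_le

theorem cycleNumber_conj (p q : Perm D) : cycleNumber (q * p * q⁻¹) = cycleNumber p := by
  refine (Setoid.classCount_eq_of_map q (fun x y => ?_) fun z => ⟨q⁻¹ z, ?_⟩).symm
  · change SameCycle p x y ↔ SameCycle (q * p * q⁻¹) (q x) (q y)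
    rw [sameCycle_conj]; simp
  · have : q (q⁻¹ z) = z := Equiv.apply_symm_apply q z
    rw [this]

theorem cycleNumber_mul_comm (p q : Perm D) : cycleNumber (p * q) = cycleNumber (q * p) := by
  rw [← cycleNumber_conj (p * q) q]; congr 1; group

theorem setoid_swap_mul_le [DecidableEq D] {p : Perm D} {u : Setoid D} {x y : D}
    (hp : SameCycle.setoid p ≤ u) (hxy : u x y) : SameCycle.setoid (swap x y * p) ≤ u := by
  refine setoid_mul_le (setoid_le_iff.2 fun z => ?_) hp
  rw [swap_apply_def]
  split_ifs with h1 h2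
  · rwa [h1]
  · rw [h2]; exact u.symm' hxy
  · exact u.refl' z

theorem setoid_le_of_swap_mul [DecidableEq D] {p : Perm D} {u : Setoid D} {x y : D}
    (hp : SameCycle.setoid (swap x y * p) ≤ u) (hxy : u x y) : SameCycle.setoid p ≤ u := by
  simpa using setoid_swap_mul_le hp hxy

/-- A swap has no effect on an orbit before it comes to one of the swapped points. -/
theorem swap_mul_pow_apply [DecidableEq D] {p : Perm D} {x y z : D} {n : ℕ}
    (h : ∀ k, 0 < k → k ≤ n → (p ^ k) z ≠ x ∧ (p ^ k) z ≠ y) :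
    ((swap x y * p) ^ n) z = (p ^ n) z := by
  induction n with
  | zero => rfl
  | succ n ih =>
    rw [pow_succ', mul_apply, ih fun k hk hkn => h k hk (by omega), mul_apply, ← mul_apply p,
      ← pow_succ']
    exact swap_apply_of_ne_of_ne (h _ (by omega) le_rfl).1 (h _ (by omega) le_rfl).2

variable [Finite D]

/-- The triangle inequality for the number of transpositions needed to write a permutation. -/
theorem cycleNumber_add_le (p q : Perm D) :
    cycleNumber p + cycleNumber q ≤ Nat.card D + cycleNumber (p * q) :=
  (Setoid.classCount_add_le _ _).trans (add_le_add (Setoid.classCount_le_card _)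
    (Setoid.classCount_le_of_le (setoid_mul_le le_sup_left le_sup_right)))

theorem exists_first_pow {p : Perm D} {x y : D} (h : SameCycle p x y) :
    ∃ n, 0 < n ∧ (p ^ n) x = y ∧ ∀ k, 0 < k → k < n → (p ^ k) x ≠ y := by
  classical
  have hex : ∃ n, 0 < n ∧ (p ^ n) x = y := by
    obtain ⟨n, hn, -, h⟩ := h.exists_pow_eq''
    exact ⟨n, hn, h⟩
  refine ⟨Nat.find hex, (Nat.find_spec hex).1, (Nat.find_spec hex).2, fun k hk hkn h => ?_⟩
  exact Nat.find_min hex hkn ⟨hk, h⟩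

section Swap

variable [DecidableEq D]

theorem cycleNumber_le_swap_mul (p : Perm D) (x y : D) :
    cycleNumber p ≤ cycleNumber (swap x y * p) + 1 :=
  Setoid.classCount_le_succ x y fun _ => setoid_swap_mul_le

theorem cycleNumber_swap_mul_le (p : Perm D) (x y : D) :
    cycleNumber (swap x y * p) ≤ cycleNumber p + 1 :=
  Setoid.classCount_le_succ x y fun _ => setoid_le_of_swap_mul

/-- Starting from `x`, the product follows `p` until it would first return to `x`, and is then
redirected to `y`. -/
theorem sameCycle_swap_mul {p : Perm D} {x y : D} (h : ¬ SameCycle p x y) :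
    SameCycle (swap x y * p) x y := by
  obtain ⟨n, hn, hx, hmin⟩ := exists_first_pow (SameCycle.refl p x)
  obtain ⟨n, rfl⟩ := Nat.exists_eq_succ_of_ne_zero hn.ne'
  refine ⟨(n + 1 : ℕ), ?_⟩
  rw [zpow_natCast, pow_succ', mul_apply, swap_mul_pow_apply, mul_apply, ← mul_apply p, ← pow_succ',
    hx, swap_apply_left]
  exact fun k hk hkn => ⟨hmin k hk (by omega), fun hy => h ⟨k, by simpa using hy⟩⟩

/-- Starting from `x`, the product follows `p` until it would first reach `y`, and is then sent back
to `x`: this closes a cycle that avoids `y`. -/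
theorem not_sameCycle_swap_mul {p : Perm D} {x y : D} (h : SameCycle p x y) (hne : x ≠ y) :
    ¬ SameCycle (swap x y * p) x y := by
  obtain ⟨n, hn, hy, hmin⟩ := exists_first_pow h
  have hx : ∀ k, 0 < k → k < n → (p ^ k) x ≠ x := by
    intro k hk hkn hkx
    obtain ⟨j, rfl⟩ := Nat.exists_eq_add_of_lt hkn
    refine hmin (j + 1) (by omega) (by omega) ?_
    rw [← hy, show k + j + 1 = (j + 1) + k by omega, pow_add p (j + 1) k, mul_apply, hkx]
  have hq : ∀ k < n, ((swap x y * p) ^ k) x = (p ^ k) x := fun k hkn =>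
    swap_mul_pow_apply fun i hi hik => ⟨hx i hi (by omega), hmin i hi (by omega)⟩
  have hqn : ((swap x y * p) ^ n) x = x := by
    obtain ⟨n, rfl⟩ := Nat.exists_eq_succ_of_ne_zero hn.ne'
    rw [pow_succ', mul_apply, hq n (by omega), mul_apply, ← mul_apply p, ← pow_succ', hy,
      swap_apply_right]
  intro hs
  obtain ⟨k, hk, hkxy⟩ := exists_pow_lt_of_sameCycle _ _ hs
  have hkn : k < n := hk.trans_le (Function.IsPeriodicPt.minimalPeriod_le hn (by
    rw [Function.IsPeriodicPt, Function.IsFixedPt, iterate_eq_pow, hqn]))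
  rw [hq k hkn] at hkxy
  rcases Nat.eq_zero_or_pos k with rfl | hk0
  · exact hne hkxy
  · exact hmin k hk0 hkn hkxy

theorem cycleNumber_swap_mul_of_not_sameCycle {p : Perm D} {x y : D} (h : ¬ SameCycle p x y) :
    cycleNumber (swap x y * p) + 1 = cycleNumber p := by
  refine le_antisymm ?_ (cycleNumber_le_swap_mul p x y)
  exact Setoid.classCount_lt_of_le (setoid_le_of_swap_mul le_rfl (sameCycle_swap_mul h))
    (sameCycle_swap_mul h) h

theorem cycleNumber_swap_mul_of_sameCycle {p : Perm D} {x y : D} (h : SameCycle p x y)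
    (hne : x ≠ y) : cycleNumber (swap x y * p) = cycleNumber p + 1 := by
  have := cycleNumber_swap_mul_of_not_sameCycle (not_sameCycle_swap_mul h hne)
  rw [swap_mul_self_mul] at this
  exact this.symm

end Swap

/-- The genus of a pair of permutations is nonnegative. -/
theorem cycleNumber_genus_le (p q : Perm D) :
    cycleNumber p + cycleNumber q + cycleNumber (p * q) ≤
      Nat.card D + 2 * (SameCycle.setoid p ⊔ SameCycle.setoid q).classCount := by
  classical
  induction hn : Nat.card D - cycleNumber p using Nat.strong_induction_on generalizing p with
  | _ n ih =>
  by_cases hp : p = 1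
  · subst hp
    have : SameCycle.setoid (1 : Perm D) ⊔ SameCycle.setoid q = SameCycle.setoid q :=
      sup_eq_right.2 (setoid_le_iff.2 fun x => Setoid.refl' _ x)
    rw [this, one_mul, cycleNumber_one, cycleNumber]
    omega
  obtain ⟨x, hx⟩ : ∃ x, p x ≠ x := by
    by_contra! h
    exact hp (Equiv.ext h)
  -- `p'` fixes `x` and has one cycle more than `p`. If `x` and `p x` are still in one joint orbit,
  -- the joint orbits do not change and `p * q` has at most one cycle more than `p' * q`. Otherwise
  -- passing from `p'` to `p` loses at most one joint orbit, and both `p` and `p * q` lose a cycle.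
  set p' := swap x (p x) * p with hp'
  have hpp : p = swap x (p x) * p' := by rw [hp', swap_mul_self_mul]
  have h1 : cycleNumber p' = cycleNumber p + 1 :=
    cycleNumber_swap_mul_of_sameCycle ⟨1, by simp⟩ hx.symm
  have hcard : cycleNumber p' ≤ Nat.card D := Setoid.classCount_le_card _
  have h2 := ih _ (by omega) p' rfl
  have h3 : SameCycle.setoid p' ⊔ SameCycle.setoid q ≤ SameCycle.setoid p ⊔ SameCycle.setoid q :=
    sup_le_sup_right (setoid_swap_mul_le le_rfl ⟨1, by simp⟩) _
  have hpq : p * q = swap x (p x) * (p' * q) := by rw [← mul_assoc, ← hpp]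
  by_cases hxy : (SameCycle.setoid p' ⊔ SameCycle.setoid q) x (p x)
  · have h4 : SameCycle.setoid p ⊔ SameCycle.setoid q = SameCycle.setoid p' ⊔ SameCycle.setoid q :=
      le_antisymm (sup_le (setoid_le_of_swap_mul le_sup_left hxy) le_sup_right) h3
    have h5 := cycleNumber_swap_mul_le (p' * q) x (p x)
    rw [h4, hpq]
    omega
  · have h4 : (SameCycle.setoid p' ⊔ SameCycle.setoid q).classCount ≤
        (SameCycle.setoid p ⊔ SameCycle.setoid q).classCount + 1 :=
      Setoid.classCount_le_succ x (p x) fun u hu hxu =>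
        sup_le (setoid_le_of_swap_mul (le_sup_left.trans hu) hxu) (le_sup_right.trans hu)
    have h5 := cycleNumber_swap_mul_of_not_sameCycle (p := p' * q) (x := x) (y := p x)
      fun h => hxy (setoid_mul_le (p := p') (q := q) le_sup_left le_sup_right h)
    rw [hpq]
    omega

end Equiv.Perm

/-! ## Noncrossing permutations -/

namespace Equiv.Perm

variable {D : Type}

theorem pow_minimalPeriod (p : Perm D) (a : D) : (p ^ Function.minimalPeriod p a) a = a := by
  rw [← iterate_eq_pow, Function.iterate_minimalPeriod]

theorem setoid_sup_inv_mul_of_le {ζ α : Perm D} (h : SameCycle.setoid α ≤ SameCycle.setoid ζ) :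
    SameCycle.setoid α ⊔ SameCycle.setoid (α⁻¹ * ζ) = SameCycle.setoid ζ := by
  rw [setoid_sup_inv_mul, sup_eq_right.2 h]

variable [Finite D]

theorem mem_of_sameCycle {p : Perm D} {s : _root_.Set D} (hs : ∀ x ∈ s, p x ∈ s) {x y : D}
    (h : SameCycle p x y) (hx : x ∈ s) : y ∈ s := by
  obtain ⟨n, rfl⟩ := h.exists_nat_pow_eq
  clear h
  induction n with
  | zero => exact hx
  | succ n ih => rw [pow_succ', mul_apply]; exact hs _ ih

open Classical in
theorem indicator_mem_invariantFunctions {p : Perm D} {s : _root_.Set D} (hs : ∀ x ∈ s, p x ∈ s) :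
    s.indicator (1 : D → ℚ) ∈ (SameCycle.setoid p).invariantFunctions := by
  intro x y h
  have : x ∈ s ↔ y ∈ s := ⟨mem_of_sameCycle hs h, mem_of_sameCycle hs (SameCycle.symm h)⟩
  simp [Set.indicator_apply, this]

theorem minimalPeriod_pos (p : Perm D) (a : D) : 0 < Function.minimalPeriod p a :=
  Function.minimalPeriod_pos_of_mem_periodicPts (Function.Injective.mem_periodicPts p.injective a)

theorem pow_injOn {p : Perm D} {a : D} {i j : ℕ} (hi : 0 < i) (hi' : i ≤ Function.minimalPeriod p a)
    (hj : 0 < j) (hj' : j ≤ Function.minimalPeriod p a) (h : (p ^ i) a = (p ^ j) a) : i = j := by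
  have := (pow_apply_eq_iff p a (ncard_sameCycle p a) i j).1 h
  obtain ⟨i, rfl⟩ := Nat.exists_eq_succ_of_ne_zero hi.ne'
  obtain ⟨j, rfl⟩ := Nat.exists_eq_succ_of_ne_zero hj.ne'
  have := Nat.ModEq.add_right_cancel' 1 this
  rw [Nat.ModEq, Nat.mod_eq_of_lt hi', Nat.mod_eq_of_lt hj'] at this
  omega

theorem exists_pow_le_of_sameCycle {p : Perm D} {a b : D} (h : SameCycle p a b) :
    ∃ k, 0 < k ∧ k ≤ Function.minimalPeriod p a ∧ (p ^ k) a = b := by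
  obtain ⟨n, hn, rfl⟩ := exists_pow_lt_of_sameCycle p a h
  rcases Nat.eq_zero_or_pos n with rfl | h0
  · exact ⟨_, hn, le_rfl, pow_minimalPeriod p a⟩
  · exact ⟨n, h0, hn.le, rfl⟩

theorem minimalPeriod_pow_apply (p : Perm D) (a : D) (n : ℕ) :
    Function.minimalPeriod p ((p ^ n) a) = Function.minimalPeriod p a := by
  rw [← ncard_sameCycle, ← ncard_sameCycle]
  congr 1
  ext y
  exact sameCycle_pow_left

/-- The open arc from `a` to `b` along a cycle of `ζ`; it goes once around if `a = b`. -/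
def arc (ζ : Perm D) (a b : D) : _root_.Set D :=
  {x | ∃ j k : ℕ, 0 < j ∧ j < k ∧ k ≤ Function.minimalPeriod ζ a ∧ (ζ ^ k) a = b ∧ (ζ ^ j) a = x}

theorem mem_arc_iff {ζ : Perm D} {a b : D} {k : ℕ} (hk : 0 < k)
    (hk' : k ≤ Function.minimalPeriod ζ a) (h : (ζ ^ k) a = b) {x : D} :
    x ∈ arc ζ a b ↔ ∃ j, 0 < j ∧ j < k ∧ (ζ ^ j) a = x := by
  constructor
  · rintro ⟨j, l, hj, hjl, hl, hb, hx⟩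
    obtain rfl : l = k := pow_injOn (by omega) hl hk hk' (hb.trans h.symm)
    exact ⟨j, hj, hjl, hx⟩
  · rintro ⟨j, hj, hjk, hx⟩
    exact ⟨j, k, hj, hjk, hk', h, hx⟩

theorem left_notMem_arc (ζ : Perm D) (a b : D) : a ∉ arc ζ a b := by
  rintro ⟨j, k, hj, hjk, hk, -, hx⟩
  have := pow_injOn hj (by omega) (minimalPeriod_pos ζ a) le_rfl (hx.trans (pow_minimalPeriod ζ a).symm)
  omega

theorem pow_notMem_arc {ζ : Perm D} {a b : D} {k l : ℕ} (hk : 0 < k) (hkl : k ≤ l)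
    (hl : l ≤ Function.minimalPeriod ζ a) (h : (ζ ^ k) a = b) : (ζ ^ l) a ∉ arc ζ a b := by
  rw [mem_arc_iff hk (hkl.trans hl) h]
  rintro ⟨j, hj, hjk, hx⟩
  have := pow_injOn hj (by omega) (by omega) hl hx
  omega

/-- Every cycle of `α` lies in a cycle of `ζ`, and the arcs `a → α a` do not cross each other. -/
structure IsNoncrossing (ζ α : Perm D) : Prop where
  le : SameCycle.setoid α ≤ SameCycle.setoid ζ
  apply_mem : ∀ a, ∀ x ∈ arc ζ a (α a), α x ∈ arc ζ a (α a)

/-- `α` and `α⁻¹ * ζ` generate the same orbits as `ζ`, so the two spaces meet in the functions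
invariant under `ζ`. Hence the identity c(α) + c(α⁻¹ζ) = |D| + c(ζ) says exactly that the two spaces
together span all functions. -/
theorem finrank_invariantFunctions_sup {ζ α : Perm D}
    (h : SameCycle.setoid α ≤ SameCycle.setoid ζ) :
    Module.finrank ℚ ((SameCycle.setoid α).invariantFunctions ⊔
      (SameCycle.setoid (α⁻¹ * ζ)).invariantFunctions : Submodule ℚ (D → ℚ)) + cycleNumber ζ =
      cycleNumber α + cycleNumber (α⁻¹ * ζ) := by
  have := Submodule.finrank_sup_add_finrank_inf_eq (SameCycle.setoid α).invariantFunctions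
    (SameCycle.setoid (α⁻¹ * ζ)).invariantFunctions
  rwa [← Setoid.invariantFunctions_sup, setoid_sup_inv_mul_of_le h,
    Setoid.finrank_invariantFunctions, Setoid.finrank_invariantFunctions,
    Setoid.finrank_invariantFunctions] at this

/-- Every basis function δ_a is the indicator of {a} ∪ arc minus the indicator of the arc from `a`
to `α a`; the first is invariant under `α⁻¹ * ζ`, the second under `α`. -/
theorem IsNoncrossing.cycleNumber_add {ζ α : Perm D} (h : IsNoncrossing ζ α) :
    cycleNumber α + cycleNumber (α⁻¹ * ζ) = Nat.card D + cycleNumber ζ := by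
  classical
  have := Fintype.ofFinite D
  rw [← finrank_invariantFunctions_sup h.le]
  congr 1
  suffices hs : (SameCycle.setoid α).invariantFunctions ⊔
      (SameCycle.setoid (α⁻¹ * ζ)).invariantFunctions = (⊤ : Submodule ℚ (D → ℚ)) by
    rw [hs, finrank_top, Module.finrank_fintype_fun_eq_card, Nat.card_eq_fintype_card]
  rw [eq_top_iff, ← (Pi.basisFun ℚ D).span_eq, Submodule.span_le]
  rintro _ ⟨a, rfl⟩
  obtain ⟨k, hk, hk', hka⟩ :=
    exists_pow_le_of_sameCycle (setoid_le_iff.1 h.le a : SameCycle ζ a (α a))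
  have hα := indicator_mem_invariantFunctions (h.apply_mem a)
  have hκ : (insert a (arc ζ a (α a))).indicator (1 : D → ℚ) ∈
      (SameCycle.setoid (α⁻¹ * ζ)).invariantFunctions := by
    -- The inverse permutation sends `x` to the point just before `α x` along `ζ`. As `α x` is in
    -- the arc or is its end `α a`, that point is in the arc or is `a`.
    rw [← setoid_inv]
    refine indicator_mem_invariantFunctions fun x hx => ?_
    have hx' : α x ∈ insert (α a) (arc ζ a (α a)) := by
      rcases hx with rfl | hx
      · exact Or.inl rfl
      · exact Or.inr (h.apply_mem a x hx)
    obtain ⟨j, hj, hjk, hjx⟩ : ∃ j, 0 < j ∧ j ≤ k ∧ (ζ ^ j) a = α x := by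
      rcases hx' with hx' | hx'
      · exact ⟨k, hk, le_rfl, hka.trans hx'.symm⟩
      · obtain ⟨j, hj, hjk, hjx⟩ := (mem_arc_iff hk hk' hka).1 hx'
        exact ⟨j, hj, hjk.le, hjx⟩
    obtain ⟨j, rfl⟩ := Nat.exists_eq_succ_of_ne_zero hj.ne'
    have : (α⁻¹ * ζ)⁻¹ x = (ζ ^ j) a := by
      rw [inv_eq_iff_eq, mul_apply, ← mul_apply ζ, ← pow_succ', hjx]
      exact (inv_eq_iff_eq.2 rfl).symm
    rw [this]
    rcases Nat.eq_zero_or_pos j with rfl | hj0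
    · exact Or.inl rfl
    · exact Or.inr ((mem_arc_iff hk hk' hka).2 ⟨j, hj0, by omega, rfl⟩)
  have : Pi.basisFun ℚ D a = (-1 : ℚ) • (arc ζ a (α a)).indicator (1 : D → ℚ) +
      (insert a (arc ζ a (α a))).indicator (1 : D → ℚ) := by
    ext x
    by_cases hxa : x = a
    · subst hxa
      simp [left_notMem_arc]
    · by_cases hx : x ∈ arc ζ a (α a) <;> simp [hxa, hx]
  rw [this]
  exact Submodule.add_mem_sup (Submodule.smul_mem _ _ hα) hκ

/-- Write δ_a = f + g with f invariant under `α` and g under `α⁻¹ * ζ`. Along the `ζ`-cycle of `a`,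
the function f drops by one just after `a`, rises by one at `α a`, and is constant in between. So
the arc is the part of this cycle where f equals f(a) - 1, and it is stable under `α` because f is.
-/
theorem isNoncrossing_of_cycleNumber_add {ζ α : Perm D}
    (hle : SameCycle.setoid α ≤ SameCycle.setoid ζ)
    (h : cycleNumber α + cycleNumber (α⁻¹ * ζ) = Nat.card D + cycleNumber ζ) :
    IsNoncrossing ζ α := by
  classical
  have := Fintype.ofFinite D
  refine ⟨hle, fun a x hx => ?_⟩
  have htop : (SameCycle.setoid α).invariantFunctions ⊔
      (SameCycle.setoid (α⁻¹ * ζ)).invariantFunctions = (⊤ : Submodule ℚ (D → ℚ)) := by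
    apply Submodule.eq_top_of_finrank_eq
    have := finrank_invariantFunctions_sup hle
    rw [Module.finrank_fintype_fun_eq_card, ← Nat.card_eq_fintype_card]
    omega
  obtain ⟨f, hf, g, hg, hfg⟩ := Submodule.mem_sup.1
    (htop ▸ Submodule.mem_top : (Pi.single a 1 : D → ℚ) ∈ _)
  have hfα : ∀ z, f (α z) = f z := fun z => (hf _ _ (⟨1, by simp⟩ : SameCycle α z (α z))).symm
  have hstep : ∀ z, f (ζ z) = f z - (if z = a then 1 else 0) + (if ζ z = α a then 1 else 0) := by
    intro z
    have h1 : g z = g (α⁻¹ (ζ z)) := hg _ _ (⟨1, by simp⟩ : SameCycle (α⁻¹ * ζ) z _)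
    have h2 : f (ζ z) = f (α⁻¹ (ζ z)) := by
      conv_lhs => rw [← show α (α⁻¹ (ζ z)) = ζ z from Equiv.apply_symm_apply α _]
      rw [hfα]
    have h3 : f z + g z = if z = a then 1 else 0 := by
      rw [← Pi.add_apply, hfg, Pi.single_apply]
    have h4 : f (α⁻¹ (ζ z)) + g (α⁻¹ (ζ z)) = if ζ z = α a then 1 else 0 := by
      rw [← Pi.add_apply, hfg, Pi.single_apply]
      simp only [inv_eq_iff_eq]
    linarith
  obtain ⟨k, hk, hk', hka⟩ :=
    exists_pow_le_of_sameCycle (setoid_le_iff.1 hle a : SameCycle ζ a (α a))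
  have hin : ∀ j, 0 < j → j < k → f ((ζ ^ j) a) = f a - 1 := by
    intro j hj hjk
    induction j with
    | zero => omega
    | succ j ih =>
      have hne : ζ ((ζ ^ j) a) ≠ α a := fun he => by
        rw [← mul_apply, ← pow_succ', ← hka] at he
        have := pow_injOn (by omega) (by omega) hk hk' he
        omega
      rw [pow_succ', mul_apply, hstep, if_neg hne]
      rcases Nat.eq_zero_or_pos j with rfl | hj0
      · simp
      · rw [ih hj0 (by omega), if_neg]
        · ring
        · intro he
          have := pow_injOn hj0 (by omega) (minimalPeriod_pos ζ a) le_rfl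
            (he.trans (pow_minimalPeriod ζ a).symm)
          omega
  have hout : ∀ j, k ≤ j → j ≤ Function.minimalPeriod ζ a → f ((ζ ^ j) a) = f a := by
    intro j hkj
    induction j, hkj using Nat.le_induction with
    | base => intro _; rw [hka, hfα]
    | succ j hkj ih =>
      intro hj
      rw [pow_succ', mul_apply, hstep, ih (by omega), if_neg, if_neg]
      · ring
      · intro he
        rw [← mul_apply, ← pow_succ', ← hka] at he
        have := pow_injOn (by omega) (by omega) hk hk' he
        omega
      · intro he
        have := pow_injOn (by omega) (by omega) (minimalPeriod_pos ζ a) le_rfl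
          (he.trans (pow_minimalPeriod ζ a).symm)
        omega
  have hax : SameCycle ζ a (α x) := by
    obtain ⟨j, -, -, rfl⟩ := (mem_arc_iff hk hk' hka).1 hx
    exact (SameCycle.trans ⟨j, by simp⟩ (setoid_le_iff.1 hle _ : SameCycle ζ _ _))
  obtain ⟨l, hl, hl', hlx⟩ := exists_pow_le_of_sameCycle hax
  obtain ⟨j, hj, hjk, rfl⟩ := (mem_arc_iff hk hk' hka).1 hx
  refine (mem_arc_iff hk hk' hka).2 ⟨l, hl, lt_of_not_ge fun hkl => ?_, hlx⟩
  have h1 := hout l hkl hl'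
  rw [hlx, hfα, hin j hj hjk] at h1
  linarith

theorem IsNoncrossing.not_sameCycle {ζ α : Perm D} (h : IsNoncrossing ζ α) {a x : D}
    (hx : x ∈ arc ζ a (α a)) : ¬ SameCycle α a x := fun hs =>
  left_notMem_arc ζ a (α a) (mem_of_sameCycle (h.apply_mem a) hs.symm hx)

/-- The cycles of a noncrossing permutation have the cyclic order of the ambient cycles. -/
theorem IsNoncrossing.induced {ζ α : Perm D} (h : IsNoncrossing ζ α) (d : D) (n : ℕ) (hn : 0 < n)
    (hs : SameCycle α d ((ζ ^ n) d)) (hmin : ∀ k, 0 < k → k < n → ¬ SameCycle α d ((ζ ^ k) d)) :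
    (ζ ^ n) d = α d := by
  obtain ⟨k, hk, hk', hkd⟩ :=
    exists_pow_le_of_sameCycle (setoid_le_iff.1 h.le d : SameCycle ζ d (α d))
  rcases lt_trichotomy n k with hnk | rfl | hnk
  · exact absurd hs (h.not_sameCycle ((mem_arc_iff hk hk' hkd).2 ⟨n, hn, hnk, rfl⟩))
  · exact hkd
  · exact absurd (hkd ▸ ⟨1, by simp⟩) (hmin k hk hnk)

/-- The cycles of a noncrossing permutation do not interlace. -/
theorem IsNoncrossing.noninterlacing {ζ α : Perm D} (h : IsNoncrossing ζ α) (a b c d : D)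
    (ho : CyclicallyOrdered ζ a b c d) (hac : SameCycle α a c) (hbd : SameCycle α b d) :
    SameCycle α a b := by
  classical
  obtain ⟨i, j, l, hi, hij, hjl, hl, rfl, rfl, rfl⟩ := ho
  simp only [iterate_eq_pow] at *
  by_contra hab
  -- The point `x` at position `p` is the last one of the `α`-cycle of `a` up to `b`, so `b` lies on
  -- the arc from `x` to `α x`. Then so does `d`, and also `c`, which is between them; but this arc
  -- contains no point of the cycle of `x`.
  set p := Nat.findGreatest (fun p => SameCycle α a ((ζ ^ p) a)) i with hp
  have hpa : SameCycle α a ((ζ ^ p) a) :=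
    Nat.findGreatest_spec (P := fun p => SameCycle α a ((ζ ^ p) a)) (Nat.zero_le i) (SameCycle.refl _ _)
  have hpi : p < i := lt_of_le_of_ne (Nat.findGreatest_le i) fun he => hab (he ▸ hpa)
  have hmax : ∀ q, p < q → q ≤ i → ¬ SameCycle α a ((ζ ^ q) a) := fun q hq hqi =>
    Nat.findGreatest_is_greatest hq hqi
  clear_value p
  set x := (ζ ^ p) a with hx
  have hpow : ∀ n, p ≤ n → (ζ ^ n) a = (ζ ^ (n - p)) x := by
    intro n hn
    rw [hx, ← mul_apply, ← pow_add, Nat.sub_add_cancel hn]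
  have hper : Function.minimalPeriod ζ x = Function.minimalPeriod ζ a := minimalPeriod_pow_apply ζ a p
  obtain ⟨q, hq, hq', hqx⟩ :=
    exists_pow_le_of_sameCycle (setoid_le_iff.1 h.le x : SameCycle ζ x (α x))
  have hiq : i - p < q := by
    by_contra! hqi
    refine hmax (p + q) (by omega) (by omega) ?_
    rw [hpow _ (by omega), Nat.add_sub_cancel_left, hqx]
    exact hpa.trans ⟨1, by simp⟩
  have hb : (ζ ^ i) a ∈ arc ζ x (α x) :=
    (mem_arc_iff hq hq' hqx).2 ⟨i - p, by omega, hiq, (hpow i hpi.le).symm⟩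
  obtain ⟨r, hr, hrq, hrd⟩ := (mem_arc_iff hq hq' hqx).1 (mem_of_sameCycle (h.apply_mem x) hbd hb)
  rw [hpow l (by omega)] at hrd
  have := pow_injOn hr (by omega) (by omega) (by omega) hrd
  exact h.not_sameCycle ((mem_arc_iff hq hq' hqx).2
    ⟨j - p, by omega, by omega, (hpow j (by omega)).symm⟩) (hpa.symm.trans hac)

/-- By `hind`, the first return along `ζ` to the `α`-cycle of `a` is at `α a`, so the arc avoids
this cycle. If `x` were on the arc and `α x` beyond it, then `a`, `x`, `α a`, `α x` would interlace.
-/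
theorem isNoncrossing_of_induced_of_noninterlacing {ζ α : Perm D}
    (hle : SameCycle.setoid α ≤ SameCycle.setoid ζ)
    (hind : ∀ (d : D) (n : ℕ), 0 < n → SameCycle α d ((ζ ^ n) d) →
      (∀ k, 0 < k → k < n → ¬ SameCycle α d ((ζ ^ k) d)) → (ζ ^ n) d = α d)
    (hint : ∀ a b c d, CyclicallyOrdered ζ a b c d →
      SameCycle α a c → SameCycle α b d → SameCycle α a b) : IsNoncrossing ζ α := by
  classical
  refine ⟨hle, fun a x hx => ?_⟩
  obtain ⟨k, hk, hk', hka⟩ :=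
    exists_pow_le_of_sameCycle (setoid_le_iff.1 hle a : SameCycle ζ a (α a))
  have hex : ∃ n, 0 < n ∧ SameCycle α a ((ζ ^ n) a) := ⟨k, hk, hka ▸ ⟨1, by simp⟩⟩
  have hfind : Nat.find hex = k := by
    have hle : Nat.find hex ≤ k := Nat.find_min' hex ⟨hk, hka ▸ ⟨1, by simp⟩⟩
    refine pow_injOn (Nat.find_spec hex).1 (hle.trans hk') hk hk' (hka ▸ ?_)
    exact hind a _ (Nat.find_spec hex).1 (Nat.find_spec hex).2
      fun n hn hnk hs => Nat.find_min hex hnk ⟨hn, hs⟩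
  obtain ⟨j, hj, hjk, hjx⟩ := (mem_arc_iff hk hk' hka).1 hx
  have hax : ¬ SameCycle α a x := fun hs =>
    Nat.find_min hex (hfind ▸ hjk) ⟨hj, hjx ▸ hs⟩
  have hxx : SameCycle α x (α x) := ⟨1, by simp⟩
  obtain ⟨l, hl, hl', hlx⟩ := exists_pow_le_of_sameCycle
    (SameCycle.trans ⟨j, by simpa using hjx⟩ (setoid_le_iff.1 hle x) : SameCycle ζ a (α x))
  rcases lt_trichotomy l k with hlk | rfl | hkl
  · exact (mem_arc_iff hk hk' hka).2 ⟨l, hl, hlk, hlx⟩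
  · exact absurd (α.injective (hka.symm.trans hlx) ▸ SameCycle.refl _ _) hax
  rcases hl'.lt_or_eq with hl' | rfl
  · refine absurd (hint a x (α a) (α x) ⟨j, k, l, hj, hjk, hkl, hl', ?_, ?_, ?_⟩ ⟨1, by simp⟩ hxx) hax
    all_goals rw [iterate_eq_pow]; assumption
  · rw [pow_minimalPeriod] at hlx
    exact absurd (hlx ▸ hxx.symm) hax

end Equiv.Perm

/-! ## Strands and layouts -/

section Strands

variable {D : Type}

theorem strandNext_iterate_two_mul (ζ : Equiv.Perm D) (n : ℕ) (a : D) :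
    (strandNext ζ)^[2 * n] (a, true) = ((ζ ^ n) a, true) := by
  induction n with
  | zero => rfl
  | succ n ih =>
    rw [show 2 * (n + 1) = (2 * n) + 1 + 1 by ring, Function.iterate_succ_apply',
      Function.iterate_succ_apply', ih, pow_succ', mul_apply]
    rfl

theorem strandNext_iterate_two_mul_add_one (ζ : Equiv.Perm D) (n : ℕ) (a : D) :
    (strandNext ζ)^[2 * n + 1] (a, true) = ((ζ ^ (n + 1)) a, false) := by
  rw [Function.iterate_succ_apply', strandNext_iterate_two_mul, pow_succ', mul_apply]
  rfl

theorem minimalPeriod_strandNext (ζ : Equiv.Perm D) (a : D) :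
    Function.minimalPeriod (strandNext ζ) (a, true) = 2 * Function.minimalPeriod ζ a := by
  apply Nat.dvd_antisymm
  · apply Function.IsPeriodicPt.minimalPeriod_dvd
    rw [Function.IsPeriodicPt, Function.IsFixedPt, strandNext_iterate_two_mul, pow_minimalPeriod]
  · have h := Function.iterate_minimalPeriod (f := strandNext ζ) (x := (a, true))
    rcases Nat.even_or_odd' (Function.minimalPeriod (strandNext ζ) (a, true)) with ⟨n, hn | hn⟩
    · rw [hn, strandNext_iterate_two_mul] at h
      rw [hn]
      refine Nat.mul_dvd_mul_left 2 (Function.IsPeriodicPt.minimalPeriod_dvd ?_)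
      rw [Function.IsPeriodicPt, Function.IsFixedPt, iterate_eq_pow]
      exact congrArg Prod.fst h
    · rw [hn, strandNext_iterate_two_mul_add_one] at h
      exact absurd (congrArg Prod.snd h) (by simp)

/-- A strand that arrives along the dart `a` and leaves along `a'` is crossed by a strand that arrives
along `b` and leaves along `b'`. -/
theorem cyclicallyOrdered_strandNext_iff {ζ : Equiv.Perm D} {a b a' b' : D} :
    CyclicallyOrdered (strandNext ζ) (a, true) (b', false) (a', false) (b, true) ↔
      ∃ p q r, 0 < p ∧ p < q ∧ q ≤ r ∧ r < Function.minimalPeriod ζ a ∧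
        (ζ ^ p) a = b' ∧ (ζ ^ q) a = a' ∧ (ζ ^ r) a = b := by
  -- The strand leaving along a dart comes just before the strand arriving by it. Hence `q ≤ r` with
  -- equality allowed, whereas `p < q` compares two leaving strands.
  constructor
  · rintro ⟨i, j, k, hi, hij, hjk, hk, h1, h2, h3⟩
    rw [minimalPeriod_strandNext] at hk
    rcases Nat.even_or_odd' i with ⟨p, rfl | rfl⟩
    · rw [strandNext_iterate_two_mul] at h1
      exact absurd (congrArg Prod.snd h1) (by simp)
    rcases Nat.even_or_odd' j with ⟨q, rfl | rfl⟩
    · rw [strandNext_iterate_two_mul] at h2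
      exact absurd (congrArg Prod.snd h2) (by simp)
    rcases Nat.even_or_odd' k with ⟨r, rfl | rfl⟩
    · rw [strandNext_iterate_two_mul_add_one] at h1 h2
      rw [strandNext_iterate_two_mul] at h3
      exact ⟨p + 1, q + 1, r, by omega, by omega, by omega, by omega, congrArg Prod.fst h1,
        congrArg Prod.fst h2, congrArg Prod.fst h3⟩
    · rw [strandNext_iterate_two_mul_add_one] at h3
      exact absurd (congrArg Prod.snd h3) (by simp)
  · rintro ⟨p, q, r, hp, hpq, hqr, hr, rfl, rfl, rfl⟩
    obtain ⟨p, rfl⟩ := Nat.exists_eq_succ_of_ne_zero hp.ne'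
    obtain ⟨q, rfl⟩ := Nat.exists_eq_succ_of_ne_zero (hp.trans hpq).ne'
    refine ⟨2 * p + 1, 2 * q + 1, 2 * r, by omega, by omega, by omega, ?_, ?_, ?_, ?_⟩
    · rw [minimalPeriod_strandNext]; omega
    · exact strandNext_iterate_two_mul_add_one ζ p a
    · exact strandNext_iterate_two_mul_add_one ζ q a
    · exact strandNext_iterate_two_mul ζ r a

variable [Finite D]

/-- The pattern puts `α b` on the arc from `a` to `α a`, hence also `b`, by stability of the arc
along cycles; but it places `b` at `α a` or beyond. -/
theorem Equiv.Perm.IsNoncrossing.not_cyclicallyOrdered {ζ α : Equiv.Perm D}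
    (h : IsNoncrossing ζ α) (a b : D) :
    ¬ CyclicallyOrdered (strandNext ζ) (a, true) (α b, false) (α a, false) (b, true) := by
  rw [cyclicallyOrdered_strandNext_iff]
  rintro ⟨p, q, r, hp, hpq, hqr, hr, hb, ha, rfl⟩
  have hmem : α ((ζ ^ r) a) ∈ arc ζ a (α a) := ⟨p, q, hp, hpq, by omega, ha, hb⟩
  have hs : SameCycle α (α ((ζ ^ r) a)) ((ζ ^ r) a) := ⟨-1, by simp⟩
  exact pow_notMem_arc (by omega) hqr hr.le ha (mem_of_sameCycle (h.apply_mem a) hs hmem)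

/-- A point `b` off the arc with `α b` on it produces the forbidden pattern. So `α⁻¹` maps the arc
into itself, and by finiteness so does `α`. Only points moved by `α` have to be tested, and for
`turn` these are reversals of steps of the circuit. -/
theorem isNoncrossing_of_not_cyclicallyOrdered {ζ α : Equiv.Perm D}
    (hle : SameCycle.setoid α ≤ SameCycle.setoid ζ)
    (h : ∀ a b, α a ≠ a → α b ≠ b →
      ¬ CyclicallyOrdered (strandNext ζ) (a, true) (α b, false) (α a, false) (b, true)) :
    IsNoncrossing ζ α := by
  refine ⟨hle, fun a x hx => ?_⟩
  have key : ∀ y ∈ arc ζ a (α a), α⁻¹ y ∈ arc ζ a (α a) := by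
    intro y hy
    obtain ⟨b, rfl⟩ := α.surjective y
    rw [show α⁻¹ (α b) = b from Equiv.symm_apply_apply α b]
    obtain ⟨k, hk, hk', hka⟩ :=
      exists_pow_le_of_sameCycle (setoid_le_iff.1 hle a : SameCycle ζ a (α a))
    obtain ⟨j, hj, hjk, hjb⟩ := (mem_arc_iff hk hk' hka).1 hy
    have hbb : SameCycle ζ (α b) b := SameCycle.symm (setoid_le_iff.1 hle b : SameCycle ζ b (α b))
    obtain ⟨l, hl, hl', hlb⟩ := exists_pow_le_of_sameCycle
      (SameCycle.trans ⟨j, by simpa using hjb⟩ hbb : SameCycle ζ a b)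
    refine (mem_arc_iff hk hk' hka).2 ⟨l, hl, lt_of_not_ge fun hkl => ?_, hlb⟩
    have hba : b ≠ a := by
      rintro rfl
      exact pow_notMem_arc hk le_rfl hk' hka (hka ▸ hy)
    have hl'' : l < Function.minimalPeriod ζ a := hl'.lt_of_ne fun he => hba (by
      rw [← hlb, he, pow_minimalPeriod])
    refine h a b (fun he => ?_) (fun he => ?_) (cyclicallyOrdered_strandNext_iff.2
      ⟨j, k, l, hj, hjk, hkl, hl'', hjb, hka, hlb⟩)
    · have := pow_injOn hk hk' (minimalPeriod_pos ζ a) le_rfl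
        ((hka.trans he).trans (pow_minimalPeriod ζ a).symm)
      omega
    · have := pow_injOn hj (by omega) hl hl' ((hjb.trans he).trans hlb.symm)
      omega
  exact mem_of_sameCycle key (sameCycle_inv.2 ⟨1, by simp⟩) hx

/-- A pair of permutations of genus zero has a common layout. -/
theorem exists_layout_of_genus_zero {ρ σ : Equiv.Perm D}
    (h : cycleNumber ρ + cycleNumber σ + cycleNumber (ρ⁻¹ * σ) =
      Nat.card D + 2 * (SameCycle.setoid ρ ⊔ SameCycle.setoid σ).classCount) :
    ∃ ζ, SameCycle.setoid ζ = SameCycle.setoid ρ ⊔ SameCycle.setoid σ ∧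
      cycleNumber ρ + cycleNumber (ρ⁻¹ * ζ) = Nat.card D + cycleNumber ζ ∧
      cycleNumber σ + cycleNumber (σ⁻¹ * ζ) = Nat.card D + cycleNumber ζ := by
  classical
  induction hn : cycleNumber ρ - (SameCycle.setoid ρ ⊔ SameCycle.setoid σ).classCount
    using Nat.strong_induction_on generalizing ρ with
  | _ n ih =>
  have hc : (SameCycle.setoid ρ ⊔ SameCycle.setoid σ).classCount ≤ cycleNumber ρ :=
    Setoid.classCount_le_of_le le_sup_left
  -- If the cycles of `ρ` are already the joint orbits, `ρ` is the layout. Otherwise two cycles of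
  -- `ρ` are merged so that the genus stays zero.
  rcases hc.eq_or_lt with hc | hc
  · have heq := Setoid.eq_of_le_of_classCount_le
      (le_sup_left : SameCycle.setoid ρ ≤ SameCycle.setoid ρ ⊔ SameCycle.setoid σ) hc.ge
    refine ⟨ρ, heq, ?_, ?_⟩
    · rw [inv_mul_cancel, cycleNumber_one, add_comm]
    · have : cycleNumber (σ⁻¹ * ρ) = cycleNumber (ρ⁻¹ * σ) := by
        rw [← cycleNumber_inv]; simp
      rw [this]
      omega
  -- The point `y = (ρ⁻¹ * σ)⁻¹ x` satisfies `σ y = ρ x`; if `σ x` were always in the `ρ`-cycle of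
  -- `ρ x`, then `σ` would preserve the cycles of `ρ`. Multiplying `ρ` by the transposition of `σ x`
  -- and `σ y` merges two cycles of `ρ`, and splits the cycle of `ρ⁻¹ * σ` through `x` and `y`.
  · obtain ⟨x, hx⟩ : ∃ x, ¬ SameCycle ρ (σ x) (σ ((ρ⁻¹ * σ)⁻¹ x)) := by
      by_contra! hall
      refine hc.ne (congrArg Setoid.classCount (sup_eq_left.2 (setoid_le_iff.2 fun x => ?_)))
      have h1 : SameCycle ρ (σ x) (ρ x) := by
        have := hall x
        simpa using this
      exact (SameCycle.trans h1 ⟨-1, by simp⟩).symm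
    set y := (ρ⁻¹ * σ)⁻¹ x with hy
    have hxy : SameCycle (ρ⁻¹ * σ) x y := ⟨-1, by simp [hy]⟩
    set ρ' := Equiv.swap (σ x) (σ y) * ρ with hρ'
    have hne : σ x ≠ σ y := fun he => hx (he ▸ SameCycle.refl _ _)
    have hJ : (SameCycle.setoid ρ ⊔ SameCycle.setoid σ) (σ x) (σ y) := by
      have h1 : (SameCycle.setoid ρ ⊔ SameCycle.setoid σ) x y :=
        (setoid_inv_mul_le (p := ρ) (q := σ) le_sup_left le_sup_right) hxy
      have h2 := setoid_le_iff.1 (le_sup_right : SameCycle.setoid σ ≤ SameCycle.setoid ρ ⊔ _)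
      exact Setoid.trans' _ (Setoid.symm' _ (h2 x)) (Setoid.trans' _ h1 (h2 y))
    have hsup : SameCycle.setoid ρ' ⊔ SameCycle.setoid σ =
        SameCycle.setoid ρ ⊔ SameCycle.setoid σ := by
      refine le_antisymm (sup_le (setoid_swap_mul_le le_sup_left hJ) le_sup_right)
        (sup_le ?_ le_sup_right)
      exact (setoid_le_of_swap_mul le_rfl (sameCycle_swap_mul hx)).trans le_sup_left
    have h1 : cycleNumber ρ' + 1 = cycleNumber ρ := cycleNumber_swap_mul_of_not_sameCycle hx
    have h2 : cycleNumber (ρ'⁻¹ * σ) = cycleNumber (ρ⁻¹ * σ) + 1 := by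
      have he : (ρ'⁻¹ * σ)⁻¹ = Equiv.swap x y * (ρ⁻¹ * σ)⁻¹ := by
        simp only [hρ', mul_inv_rev, inv_inv, Equiv.swap_inv]
        have := Equiv.mul_swap_eq_swap_mul σ⁻¹ (σ x) (σ y)
        simp only [show ∀ z, σ⁻¹ (σ z) = z from Equiv.symm_apply_apply σ] at this
        rw [← mul_assoc, this, mul_assoc]
      rw [← cycleNumber_inv, he, cycleNumber_swap_mul_of_sameCycle, cycleNumber_inv]
      · exact sameCycle_inv.2 hxy
      · exact fun he => hne (congrArg σ he)
    obtain ⟨ζ, hζ, hζρ, hζσ⟩ := ih _ (by rw [hsup]; omega) (by rw [hsup]; omega) rfl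
    rw [hsup] at hζ
    refine ⟨ζ, hζ, ?_, hζσ⟩
    -- The layout of `ρ'` serves for `ρ`: `ρ` has one cycle more than `ρ'`, and `ρ⁻¹ * ζ` has at
    -- most one fewer than `ρ'⁻¹ * ζ`. This is one bound, and the genus inequality `h4` is the
    -- other.
    have h3 : cycleNumber (ρ'⁻¹ * ζ) ≤ cycleNumber (ρ⁻¹ * ζ) + 1 := by
      have he : (ρ'⁻¹ * ζ)⁻¹ = ζ⁻¹ * (Equiv.swap (σ x) (σ y) * ρ) := by simp [hρ']
      rw [← cycleNumber_inv, he, cycleNumber_mul_comm, mul_assoc,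
        ← cycleNumber_inv (ρ⁻¹ * ζ), mul_inv_rev, inv_inv, cycleNumber_mul_comm ζ⁻¹ ρ]
      exact cycleNumber_swap_mul_le _ _ _
    have h4 := cycleNumber_genus_le ρ (ρ⁻¹ * ζ)
    rw [setoid_sup_inv_mul_of_le (hζ ▸ le_sup_left), mul_inv_cancel_left] at h4
    have h5 : (SameCycle.setoid ζ).classCount = cycleNumber ζ := rfl
    omega

end Strands

/-! ## More counting of cycles -/

theorem Setoid.classCount_eq_card {D F : Type} {r : Setoid D} (f : D → F)
    (hf : ∀ x y, r x y ↔ f x = f y) (hs : Function.Surjective f) : r.classCount = Nat.card F :=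
  Nat.card_congr (Equiv.ofBijective (Quotient.lift f fun x y => (hf x y).1) ⟨by
    rintro ⟨x⟩ ⟨y⟩ h
    exact Quotient.sound ((hf x y).2 h), fun z =>
    let ⟨x, hx⟩ := hs z
    ⟨Quotient.mk r x, hx⟩⟩)

namespace Equiv.Perm

theorem setoid_le_ker {D F : Type} {p : Perm D} {f : D → F} (h : ∀ x, f (p x) = f x) {x y : D}
    (hxy : SameCycle p x y) : f x = f y :=
  (setoid_le_iff.2 fun z => (h z).symm : SameCycle.setoid p ≤ Setoid.ker f) hxy

theorem SameCycle.map {D E : Type} {p : Perm D} {q : Perm E} {f : D → E}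
    (h : ∀ x, SameCycle q (f x) (f (p x))) {x y : D} (hxy : SameCycle p x y) :
    SameCycle q (f x) (f y) :=
  (setoid_le_iff.2 h : SameCycle.setoid p ≤ (SameCycle.setoid q).comap f) hxy

theorem cycleNumber_sumCongr {D E : Type} [Finite D] [Finite E] (p : Perm D) (q : Perm E) :
    cycleNumber (sumCongr p q) = cycleNumber p + cycleNumber q := by
  refine (Setoid.classCount_eq_card (Sum.map (Quotient.mk (SameCycle.setoid p))
    (Quotient.mk (SameCycle.setoid q))) (fun x y => ⟨fun h => ?_, fun h => ?_⟩) ?_).trans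
    Nat.card_sum
  · refine setoid_le_ker (p := sumCongr p q) ?_ h
    rintro (x | x)
    · exact congrArg Sum.inl (Quotient.sound (⟨-1, by simp⟩ : SameCycle p (p x) x))
    · exact congrArg Sum.inr (Quotient.sound (⟨-1, by simp⟩ : SameCycle q (q x) x))
  · rcases x with x | x <;> rcases y with y | y
    · have hxy : SameCycle p x y := Quotient.exact (Sum.inl_injective h)
      exact hxy.map (q := sumCongr p q) fun z => ⟨1, by simp⟩
    · exact absurd h (by simp)
    · exact absurd h (by simp)
    · have hxy : SameCycle q x y := Quotient.exact (Sum.inr_injective h)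
      exact hxy.map (q := sumCongr p q) fun z => ⟨1, by simp⟩
  · rintro (z | z)
    · obtain ⟨x, rfl⟩ := Quotient.exists_rep z
      exact ⟨Sum.inl x, rfl⟩
    · obtain ⟨x, rfl⟩ := Quotient.exists_rep z
      exact ⟨Sum.inr x, rfl⟩

theorem cycleNumber_ofSubtype {D : Type} [Finite D] {P : D → Prop} [DecidablePred P]
    (p : Perm (Subtype P)) :
    cycleNumber (ofSubtype p) + Nat.card (Subtype P) = cycleNumber p + Nat.card D := by
  let f : D → Quotient (SameCycle.setoid p) ⊕ {d // ¬ P d} := fun d =>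
    if h : P d then Sum.inl (Quotient.mk _ ⟨d, h⟩) else Sum.inr ⟨d, h⟩
  have hf : ∀ x : Subtype P, f x = Sum.inl (Quotient.mk _ x) := fun x => dif_pos x.2
  have hf' : ∀ x (h : ¬ P x), f x = Sum.inr ⟨x, h⟩ := fun x h => dif_neg h
  have hcount : cycleNumber (ofSubtype p) = cycleNumber p + Nat.card {d // ¬ P d} := by
    refine (Setoid.classCount_eq_card f (fun x y => ⟨fun h => ?_, fun h => ?_⟩) ?_).trans
      Nat.card_sum
    · refine setoid_le_ker (p := ofSubtype p) (fun z => ?_) h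
      by_cases hz : P z
      · rw [ofSubtype_apply_of_mem p hz, hf, hf ⟨z, hz⟩]
        exact congrArg Sum.inl (Quotient.sound (⟨-1, by simp⟩ : SameCycle p (p ⟨z, hz⟩) ⟨z, hz⟩))
      · rw [ofSubtype_apply_of_not_mem p hz]
    · by_cases hx : P x <;> by_cases hy : P y
      · rw [hf ⟨x, hx⟩, hf ⟨y, hy⟩] at h
        have hxy : SameCycle p ⟨x, hx⟩ ⟨y, hy⟩ := Quotient.exact (Sum.inl_injective h)
        exact hxy.map (q := ofSubtype p) (f := Subtype.val) fun z => ⟨1, by simp⟩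
      · rw [hf ⟨x, hx⟩, hf' y hy] at h
        exact absurd h (by simp)
      · rw [hf ⟨y, hy⟩, hf' x hx] at h
        exact absurd h (by simp)
      · rw [hf' x hx, hf' y hy] at h
        have hxy : x = y := congrArg Subtype.val (Sum.inr_injective h)
        rw [hxy]
    · rintro (z | x)
      · obtain ⟨x, rfl⟩ := Quotient.exists_rep z
        exact ⟨x, hf x⟩
      · exact ⟨x, hf' x x.2⟩
  rw [hcount, add_assoc, add_comm (Nat.card {d // ¬ P d}), ← Nat.card_sum,
    Nat.card_congr (Equiv.sumCompl P)]

theorem cycleCount_eq_cycleNumber_subtypePerm {D : Type} (p : Perm D) {S : _root_.Set D}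
    (h : ∀ x, p x ∈ S ↔ x ∈ S) : cycleCount p S = cycleNumber (p.subtypePerm h) := by
  rw [cycleCount, cycleNumber, ← Nat.card_coe_set_eq]
  symm
  refine Setoid.classCount_eq_card
    (fun x : S => (⟨Quotient.mk (SameCycle.setoid p) x, Set.mem_image_of_mem _ x.2⟩ :
      (Quotient.mk (SameCycle.setoid p) '' S : _root_.Set _))) (fun x y => ?_) ?_
  · rw [Subtype.mk.injEq]
    refine (sameCycle_subtypePerm : SameCycle (p.subtypePerm h) x y ↔ _).trans ?_
    exact ⟨fun h => Quotient.sound h, fun h => Quotient.exact h⟩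
  · rintro ⟨_, x, hx, rfl⟩
    exact ⟨⟨x, hx⟩, rfl⟩

end Equiv.Perm

/-! ## Euler's formula -/

namespace RotationSystem

variable (X : RotationSystem)

theorem rot_mul_face : X.rot * X.face = X.rev := mul_inv_cancel_left _ _

theorem rev_inv : X.rev⁻¹ = X.rev := by
  ext d; rw [inv_eq_iff_eq, X.rev_rev]

theorem component_eq_sup_face : X.component = SameCycle.setoid X.face ⊔ SameCycle.setoid X.rev := by
  refine le_antisymm (sup_le ?_ le_sup_right) (sup_le ?_ le_sup_right)
  · have : X.rot = X.rev * X.face⁻¹ := by rw [← rot_mul_face, mul_inv_cancel_right]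
    rw [this]
    exact setoid_mul_le le_sup_right (by rw [setoid_inv]; exact le_sup_left)
  · exact setoid_inv_mul_le le_sup_left le_sup_right

theorem component_rot (d : X.Dart) : X.component d (X.rot d) :=
  setoid_le_iff.1 (le_sup_left : SameCycle.setoid X.rot ≤ X.component) d

theorem component_rev (d : X.Dart) : X.component d (X.rev d) :=
  setoid_le_iff.1 (le_sup_right : SameCycle.setoid X.rev ≤ X.component) d

theorem component_apply_iff {p : Equiv.Perm X.Dart} (hp : ∀ x, X.component x (p x)) (d x : X.Dart) :
    p x ∈ {d' | X.component d d'} ↔ x ∈ {d' | X.component d d'} :=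
  ⟨fun h => X.component.trans' h (X.component.symm' (hp x)), fun h => X.component.trans' h (hp x)⟩

theorem component_face (d : X.Dart) : X.component d (X.face d) :=
  setoid_le_iff.1 (X.component_eq_sup_face ▸ le_sup_left : SameCycle.setoid X.face ≤ X.component) d

theorem cycleNumber_rev : Nat.card X.Dart = 2 * cycleNumber X.rev := by
  rw [X.card_dart, edgeCount, cycleCount_univ]

/-- The genus is nonnegative. -/
theorem euler_le : cycleNumber X.rot + cycleNumber X.face ≤
    cycleNumber X.rev + 2 * X.component.classCount := by
  -- The product of `rot` and `face` is `rev`, and the number of darts is twice the number of cycles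
  -- of `rev`.
  have h := cycleNumber_genus_le X.rot X.face
  rw [rot_mul_face, cycleNumber_rev, face, setoid_sup_inv_mul] at h
  change _ ≤ _ + 2 * X.component.classCount at h
  rw [← face] at h
  omega

theorem isPlanarMap_iff : X.IsPlanarMap ↔ X.component = ⊤ ∧
    cycleNumber X.rot + cycleNumber X.face = cycleNumber X.rev + 2 := by
  rw [IsPlanarMap, IsSpherical, cycleCount_univ, cycleCount_univ, cycleCount_univ]

/-- The connected component of a dart. -/
def restrict (d : X.Dart) : RotationSystem where
  Dart := {d' // X.component d d'}
  finite_dart := inferInstance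
  rev := X.rev.subtypePerm (X.component_apply_iff X.component_rev d)
  rot := X.rot.subtypePerm (X.component_apply_iff X.component_rot d)
  rev_rev x := Subtype.ext (X.rev_rev x)
  rev_ne x h := X.rev_ne x (congrArg Subtype.val h)
  root := ⟨d, X.component.refl' d⟩

theorem component_restrict (d : X.Dart) : (X.restrict d).component = ⊤ := by
  let Y := X.restrict d
  -- The classes of `u` are the set of darts connected to `d` inside the restriction, and its
  -- complement. Both are stable under `rot` and `rev`, so the first contains the whole component of
  -- `d`.
  let u : Setoid X.Dart := Setoid.ker fun x => ∃ h : X.component d x, Y.component Y.root ⟨x, h⟩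
  have hu : X.component ≤ u := by
    refine sup_le (setoid_le_iff.2 fun x => propext ?_) (setoid_le_iff.2 fun x => propext ?_)
    · constructor
      · rintro ⟨h, hx⟩
        exact ⟨_, Y.component.trans' hx (Y.component_rot _)⟩
      · rintro ⟨h, hx⟩
        refine ⟨X.component.trans' h (X.component.symm' (X.component_rot x)), ?_⟩
        exact Y.component.trans' hx (Y.component.symm' (Y.component_rot _))
    · constructor
      · rintro ⟨h, hx⟩
        exact ⟨_, Y.component.trans' hx (Y.component_rev _)⟩
      · rintro ⟨h, hx⟩
        refine ⟨X.component.trans' h (X.component.symm' (X.component_rev x)), ?_⟩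
        exact Y.component.trans' hx (Y.component.symm' (Y.component_rev _))
  have hroot : ∀ x, Y.component Y.root x := fun x =>
    (cast (hu x.2) ⟨X.component.refl' d, Y.component.refl' _⟩ :
      ∃ h : X.component d x.1, Y.component Y.root ⟨x.1, h⟩).2
  exact le_antisymm le_top fun {x y} _ => Y.component.trans' (Y.component.symm' (hroot x)) (hroot y)

theorem euler_component_le (d : X.Dart) :
    cycleCount X.rot {d' | X.component d d'} + cycleCount X.face {d' | X.component d d'} ≤
      cycleCount X.rev {d' | X.component d d'} + 2 := by
  have hface := X.component_apply_iff X.component_face d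
  have h := (X.restrict d).euler_le
  have : Nonempty (X.restrict d).Dart := ⟨(X.restrict d).root⟩
  rw [component_restrict, Setoid.classCount_top] at h
  rw [cycleCount_eq_cycleNumber_subtypePerm X.rot (X.component_apply_iff X.component_rot d),
    cycleCount_eq_cycleNumber_subtypePerm X.rev (X.component_apply_iff X.component_rev d),
    cycleCount_eq_cycleNumber_subtypePerm X.face hface]
  have hf : X.face.subtypePerm hface = (X.restrict d).face := by
    refine (eq_inv_mul_iff_mul_eq (G := Equiv.Perm (X.restrict d).Dart)).2
      (Equiv.ext fun x => Subtype.ext ?_)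
    exact congrArg (fun p : Equiv.Perm X.Dart => p x.1) X.rot_mul_face
  rw [hf]
  exact h

/-- The cycles of a permutation are counted component by component. -/
theorem cycleNumber_eq_sum [Fintype (Quotient X.component)] {p : Equiv.Perm X.Dart}
    (hp : SameCycle.setoid p ≤ X.component) :
    cycleNumber p = ∑ q : Quotient X.component, cycleCount p {d | X.component q.out d} := by
  classical
  let π : Quotient (SameCycle.setoid p) → Quotient X.component := Quotient.map id hp
  have h : cycleNumber p = ∑ q : Quotient X.component, Nat.card {z // π z = q} := by
    rw [← Nat.card_sigma, Nat.card_congr (Equiv.sigmaFiberEquiv π)]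
    rfl
  rw [h]
  refine Finset.sum_congr rfl fun q _ => ?_
  rw [cycleCount, ← Nat.card_coe_set_eq]
  congr 2
  ext z
  induction z using Quotient.inductionOn with
  | _ d =>
  constructor
  · intro hd
    exact ⟨d, Quotient.exact ((Quotient.out_eq q).trans hd.symm), rfl⟩
  · rintro ⟨d', hd', h⟩
    rw [← h]
    exact (Quotient.sound hd').symm.trans (Quotient.out_eq q)

/-- All components are spheres if and only if Euler's formula holds in total. -/
theorem forall_isSpherical_iff : (∀ d, X.IsSpherical {d' | X.component d d'}) ↔
    cycleNumber X.rot + cycleNumber X.face =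
      cycleNumber X.rev + 2 * X.component.classCount := by
  classical
  have := Fintype.ofFinite (Quotient X.component)
  have h2 : 2 * X.component.classCount = ∑ _q : Quotient X.component, 2 := by
    rw [Finset.sum_const, smul_eq_mul, mul_comm, Finset.card_univ, ← Nat.card_eq_fintype_card]
    rfl
  -- Euler's inequality holds for each component, so the sums agree only if every term is an
  -- equality.
  rw [X.cycleNumber_eq_sum le_sup_left, X.cycleNumber_eq_sum le_sup_right,
    X.cycleNumber_eq_sum (X.component_eq_sup_face ▸ le_sup_left), h2, ← Finset.sum_add_distrib,
    ← Finset.sum_add_distrib,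
    Finset.sum_eq_sum_iff_of_le fun q _ => X.euler_component_le q.out]
  constructor
  · exact fun h q _ => h q.out
  · intro h d
    have hd : {d' | X.component d d'} = {d' | X.component (Quotient.mk X.component d).out d'} := by
      ext d'
      have := Quotient.mk_out (s := X.component) d
      exact ⟨fun h => X.component.trans' this h, fun h => X.component.trans' (X.component.symm' this) h⟩
    rw [IsSpherical, hd]
    exact h _ (Finset.mem_univ _)

end RotationSystem

/-! ## Cutting along a circuit -/

namespace RotationSystem

variable (X : RotationSystem)

theorem face_rev (d : X.Dart) : X.face (X.rev d) = X.rot⁻¹ d :=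
  congrArg (X.rot⁻¹ : Equiv.Perm X.Dart) (X.rev_rev d)

theorem component_eq_top_of_faceCount (h : X.faceCount = 1) : X.component = ⊤ := by
  rw [faceCount, cycleCount_univ] at h
  refine top_le_iff.1 (le_trans ?_ (X.component_eq_sup_face ▸ le_sup_left :
    SameCycle.setoid X.face ≤ X.component))
  exact (Setoid.eq_top_of_classCount_le_one h.le).ge

end RotationSystem

/-! ### The tree of a circuit and its turns. -/

namespace DecoratedBubbles

variable (X : DecoratedBubbles)

/-- The part of the conditions on the circuit that does not involve the vertices. -/
structure IsCircuit (m : ℕ) : Prop where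
  start : X.circuit 0 = X.root
  length : ∀ i j, X.circuit i = X.circuit j ↔ i ≡ j [MOD 2 * m]
  both : ∀ i, ∃ j, X.circuit j = X.rev (X.circuit i)

/-- The darts of the circuit. -/
def OnCircuit (d : X.Dart) : Prop := ∃ i, X.circuit i = d

abbrev CircuitDart : Type := {d // X.OnCircuit d}

/-- A step of the circuit, as a dart of the circuit. -/
def step (i : ℕ) : X.CircuitDart := ⟨X.circuit i, i, rfl⟩

variable {X} {m : ℕ}

theorem exists_step (c : X.CircuitDart) : ∃ i, X.step i = c :=
  let ⟨i, hi⟩ := c.2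
  ⟨i, Subtype.ext hi⟩


theorem IsCircuit.step_eq_iff (h : X.IsCircuit m) (i j : ℕ) :
    X.step i = X.step j ↔ i ≡ j [MOD 2 * m] :=
  Subtype.ext_iff.trans (h.length i j)

theorem IsCircuit.onCircuit_rev (h : X.IsCircuit m) (d : X.Dart) :
    X.OnCircuit (X.rev d) ↔ X.OnCircuit d := by
  have key : ∀ d, X.OnCircuit d → X.OnCircuit (X.rev d) := by
    rintro _ ⟨i, rfl⟩
    exact h.both i
  exact ⟨fun hd => X.rev_rev d ▸ key _ hd, key d⟩

/-- Congruence modulo 0 is equality, so for `m = 0` the circuit would inject ℕ into a finite set. -/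
theorem IsCircuit.pos (h : X.IsCircuit m) : 0 < m := by
  rcases Nat.eq_zero_or_pos m with rfl | hm
  · have hinj : Function.Injective X.circuit := fun i j hij => by
      simpa [Nat.modEq_zero_iff] using (h.length i j).1 hij
    exact absurd hinj (not_injective_infinite_finite _)
  · exact hm

theorem IsCircuit.card_circuitDart (h : X.IsCircuit m) : Nat.card X.CircuitDart = 2 * m := by
  have hm := h.pos
  let e : Fin (2 * m) → X.CircuitDart := fun i => X.step i
  have he : Function.Bijective e := by
    constructor
    · intro i j hij
      have := (h.step_eq_iff i j).1 hij
      rw [Nat.ModEq, Nat.mod_eq_of_lt i.2, Nat.mod_eq_of_lt j.2] at this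
      exact Fin.ext this
    · intro c
      obtain ⟨i, rfl⟩ := exists_step c
      exact ⟨⟨i % (2 * m), Nat.mod_lt _ (by omega)⟩, (h.step_eq_iff _ _).2 (Nat.mod_modEq i _)⟩
  rw [← Nat.card_congr (Equiv.ofBijective e he), Nat.card_fin]

/-- The next step of the circuit. -/
noncomputable def IsCircuit.next (h : X.IsCircuit m) : Equiv.Perm X.CircuitDart :=
  Equiv.ofBijective (fun c => X.step (c.2.choose + 1)) <| Finite.injective_iff_bijective.1 <| by
    intro c c' hc
    have := Nat.ModEq.add_right_cancel' 1 ((h.step_eq_iff _ _).1 hc)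
    exact Subtype.ext (c.2.choose_spec.symm.trans
      (((h.length _ _).2 this).trans c'.2.choose_spec))

theorem IsCircuit.next_step (h : X.IsCircuit m) (i : ℕ) : h.next (X.step i) = X.step (i + 1) :=
  (h.step_eq_iff _ _).2 (Nat.ModEq.add_right 1
    ((h.length _ _).1 (X.step i).2.choose_spec))

theorem IsCircuit.next_pow (h : X.IsCircuit m) (i : ℕ) : (h.next ^ i) (X.step 0) = X.step i := by
  induction i with
  | zero => rfl
  | succ i ih => rw [pow_succ', mul_apply, ih, h.next_step]

theorem IsCircuit.cycleNumber_next (h : X.IsCircuit m) : cycleNumber h.next = 1 := by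
  have : SameCycle.setoid h.next = ⊤ := by
    have key : ∀ c, SameCycle h.next (X.step 0) c := fun c => by
      obtain ⟨i, rfl⟩ := exists_step c
      exact ⟨i, by rw [zpow_natCast, h.next_pow]⟩
    exact le_antisymm le_top fun {x y} _ => (key x).symm.trans (key y)
  have hne : Nonempty X.CircuitDart := ⟨X.step 0⟩
  rw [cycleNumber, this, Setoid.classCount_top]

/-- The reversal of the darts of the circuit. -/
def IsCircuit.revStep (h : X.IsCircuit m) : Equiv.Perm X.CircuitDart :=
  X.rev.subtypePerm h.onCircuit_rev

/-- The tree whose contour walk follows the circuit. -/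
noncomputable abbrev IsCircuit.tree (h : X.IsCircuit m) : RotationSystem where
  Dart := X.CircuitDart
  finite_dart := inferInstance
  rev := h.revStep
  rot := h.next * h.revStep
  rev_rev c := Subtype.ext (X.rev_rev c)
  rev_ne c hc := X.rev_ne c (congrArg Subtype.val hc)
  root := X.step 0

theorem IsCircuit.tree_rot_mul_rev (h : X.IsCircuit m) : h.tree.rot * h.tree.rev = h.next := by
  ext c
  exact congrArg (fun c => (h.next c).1) (Subtype.ext (X.rev_rev c) : h.revStep (h.revStep c) = c)

theorem IsCircuit.contour_tree (h : X.IsCircuit m) (i : ℕ) : h.tree.contour i = X.step i := by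
  rw [RotationSystem.contour, h.tree_rot_mul_rev]
  exact h.next_pow i

theorem IsCircuit.cycleNumber_tree_rev (h : X.IsCircuit m) : cycleNumber h.tree.rev = m := by
  have h1 := h.tree.cycleNumber_rev
  have h2 : Nat.card h.tree.Dart = 2 * m := h.card_circuitDart
  omega

/-- Reversal conjugates `face` to the inverse of the contour walk, which is a single cycle. -/
theorem IsCircuit.cycleNumber_tree_face (h : X.IsCircuit m) : cycleNumber h.tree.face = 1 := by
  have : h.tree.face = h.tree.rev * h.next⁻¹ * h.tree.rev⁻¹ := by
    rw [← h.tree_rot_mul_rev, mul_inv_rev, mul_inv_cancel_left, h.tree.rev_inv]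
    rfl
  rw [this, cycleNumber_conj, cycleNumber_inv, h.cycleNumber_next]

theorem IsCircuit.component_tree (h : X.IsCircuit m) : h.tree.component = ⊤ :=
  h.tree.component_eq_top_of_faceCount (by
    rw [RotationSystem.faceCount, cycleCount_univ, h.cycleNumber_tree_face])

theorem IsCircuit.cycleNumber_tree_rot_le (h : X.IsCircuit m) : cycleNumber h.tree.rot ≤ m + 1 := by
  have := h.tree.euler_le
  have hne : Nonempty h.tree.Dart := ⟨X.step 0⟩
  rw [h.component_tree, Setoid.classCount_top, h.cycleNumber_tree_face, h.cycleNumber_tree_rev] at this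
  omega

/-- Connectedness, the single face and the `m` edges are automatic, so only the number of vertices
is at stake in Euler's formula. -/
theorem IsCircuit.isPlaneTree_tree_iff (h : X.IsCircuit m) :
    h.tree.IsPlaneTree m ↔ cycleNumber h.tree.rot = m + 1 := by
  rw [RotationSystem.IsPlaneTree, RotationSystem.isPlanarMap_iff, RotationSystem.faceCount,
    RotationSystem.edgeCount, cycleCount_univ, cycleCount_univ, h.cycleNumber_tree_face,
    h.cycleNumber_tree_rev, h.component_tree]
  constructor
  · rintro ⟨⟨-, h⟩, -⟩; omega
  · intro h; exact ⟨⟨rfl, by omega⟩, rfl, rfl⟩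

open Classical in
/-- At the head of a step of the circuit, one turns into the next step. -/
noncomputable def IsCircuit.turn (h : X.IsCircuit m) : Equiv.Perm X.Dart :=
  ofSubtype (h.next * h.revStep)

theorem IsCircuit.turn_coe (h : X.IsCircuit m) (c : X.CircuitDart) :
    h.turn c = h.next (h.revStep c) := by
  classical
  exact ofSubtype_apply_coe _ _

theorem IsCircuit.turn_rev_circuit (h : X.IsCircuit m) (i : ℕ) :
    h.turn (X.rev (X.circuit i)) = X.circuit (i + 1) := by
  have h1 := h.turn_coe (h.revStep (X.step i))
  have h2 : h.revStep (h.revStep (X.step i)) = X.step i := h.tree.rev_rev _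
  rw [h2, h.next_step] at h1
  exact h1

theorem IsCircuit.turn_of_not (h : X.IsCircuit m) {d : X.Dart} (hd : ¬ X.OnCircuit d) :
    h.turn d = d := by
  classical
  exact ofSubtype_apply_of_not_mem _ hd

theorem IsCircuit.cycleNumber_turn (h : X.IsCircuit m) :
    cycleNumber h.turn + 2 * m = cycleNumber h.tree.rot + Nat.card X.Dart := by
  classical
  rw [← h.card_circuitDart]
  exact cycleNumber_ofSubtype _

/-! ### The map cut along the circuit. -/

open Classical in
/-- The reversal of darts in the map obtained by cutting along the circuit. -/
noncomputable def IsCircuit.cutRevFun (h : X.IsCircuit m) :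
    X.Dart ⊕ X.CircuitDart → X.Dart ⊕ X.CircuitDart
  | Sum.inl d => if hd : X.OnCircuit d then Sum.inr (h.revStep ⟨d, hd⟩) else Sum.inl (X.rev d)
  | Sum.inr c => Sum.inl (X.rev c)

theorem IsCircuit.cutRevFun_coe (h : X.IsCircuit m) (c : X.CircuitDart) :
    h.cutRevFun (Sum.inl c) = Sum.inr (h.revStep c) := dif_pos c.2

theorem IsCircuit.cutRevFun_of_not (h : X.IsCircuit m) {d : X.Dart} (hd : ¬ X.OnCircuit d) :
    h.cutRevFun (Sum.inl d) = Sum.inl (X.rev d) := dif_neg hd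

theorem IsCircuit.cutRevFun_inr (h : X.IsCircuit m) (c : X.CircuitDart) :
    h.cutRevFun (Sum.inr c) = Sum.inl (X.rev c) := rfl

theorem IsCircuit.cutRevFun_involutive (h : X.IsCircuit m) : Function.Involutive h.cutRevFun := by
  rintro (d | c)
  · by_cases hd : X.OnCircuit d
    · have := h.cutRevFun_coe ⟨d, hd⟩
      rw [this]
      exact congrArg Sum.inl (X.rev_rev d)
    · rw [h.cutRevFun_of_not hd, h.cutRevFun_of_not (mt (h.onCircuit_rev d).1 hd), X.rev_rev]
  · refine (h.cutRevFun_coe (h.revStep c)).trans (congrArg Sum.inr (h.tree.rev_rev c))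

theorem IsCircuit.cutRevFun_ne (h : X.IsCircuit m) (x : X.Dart ⊕ X.CircuitDart) :
    h.cutRevFun x ≠ x := by
  rcases x with d | c
  · by_cases hd : X.OnCircuit d
    · rw [h.cutRevFun_coe ⟨d, hd⟩]; simp
    · rw [h.cutRevFun_of_not hd]
      exact fun he => X.rev_ne d (Sum.inl_injective he)
  · rw [h.cutRevFun_inr]; simp

/-- The map obtained by cutting along the circuit: every step of the circuit gets a second dart,
which has the new external face on its left. -/
noncomputable abbrev IsCircuit.cut (h : X.IsCircuit m) : RotationSystem where
  Dart := X.Dart ⊕ X.CircuitDart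
  finite_dart := inferInstance
  rev := h.cutRevFun_involutive.toPerm
  rot := h.cutRevFun_involutive.toPerm * (Equiv.Perm.sumCongr X.face h.next)⁻¹
  rev_rev := h.cutRevFun_involutive
  rev_ne := h.cutRevFun_ne
  root := Sum.inr (X.step 0)

theorem IsCircuit.cut_face (h : X.IsCircuit m) :
    h.cut.face = Equiv.Perm.sumCongr X.face h.next := by
  change (h.cut.rev * (Equiv.Perm.sumCongr X.face h.next)⁻¹)⁻¹ * h.cut.rev = _
  rw [mul_inv_rev, inv_inv, inv_mul_cancel_right]

theorem IsCircuit.cut_rot_inv (h : X.IsCircuit m) :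
    h.cut.rot⁻¹ = Equiv.Perm.sumCongr X.face h.next * h.cut.rev := by
  change (h.cut.rev * (Equiv.Perm.sumCongr X.face h.next)⁻¹)⁻¹ = _
  rw [mul_inv_rev, inv_inv, h.cut.rev_inv]

theorem IsCircuit.boundary_cut (h : X.IsCircuit m) (i : ℕ) :
    h.cut.boundary i = Sum.inr (X.step i) := by
  induction i with
  | zero => rfl
  | succ i ih =>
    have : h.cut.boundary (i + 1) = h.cut.face (h.cut.boundary i) := by
      rw [RotationSystem.boundary, pow_succ', mul_apply]; rfl
    rw [this, ih, h.cut_face, ← h.next_step]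
    rfl

theorem IsCircuit.isBoundary_cut_inr (h : X.IsCircuit m) (c : X.CircuitDart) :
    h.cut.IsBoundary (Sum.inr c) := by
  obtain ⟨i, rfl⟩ := exists_step c
  exact ⟨i, h.boundary_cut i⟩

theorem IsCircuit.not_isBoundary_cut_inl (h : X.IsCircuit m) (d : X.Dart) :
    ¬ h.cut.IsBoundary (Sum.inl d) := by
  intro hd
  obtain ⟨i, -, hi⟩ := exists_pow_lt_of_sameCycle _ _ hd
  have := (h.boundary_cut i).symm.trans hi
  simp at this

theorem IsCircuit.cycleNumber_cut_face (h : X.IsCircuit m) :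
    cycleNumber h.cut.face = cycleNumber X.face + 1 := by
  rw [h.cut_face, cycleNumber_sumCongr, h.cycleNumber_next]

theorem IsCircuit.cycleNumber_cut_rev (h : X.IsCircuit m) :
    cycleNumber h.cut.rev = cycleNumber X.rev + m := by
  have h1 := h.cut.cycleNumber_rev
  have h2 := X.cycleNumber_rev
  have h3 : Nat.card h.cut.Dart = Nat.card X.Dart + 2 * m := by
    rw [← h.card_circuitDart]; exact Nat.card_sum
  omega

/-- The cycle on the original darts that corresponds to the vertex of a dart of the cut map. -/
noncomputable def IsCircuit.cutClass (h : X.IsCircuit m) :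
    X.Dart ⊕ X.CircuitDart → Quotient (SameCycle.setoid (h.turn⁻¹ * X.rot))
  | Sum.inl d => Quotient.mk _ d
  | Sum.inr c => Quotient.mk _ (X.rot⁻¹ c)

theorem IsCircuit.sameCycle_turn_inv_mul_rot (h : X.IsCircuit m) (d : X.Dart) :
    SameCycle (h.turn⁻¹ * X.rot) (X.rot⁻¹ (h.turn d)) d := ⟨1, by simp⟩

/-- Turning clockwise in the cut map, one passes from an old dart `d` on the circuit to the new dart
of `turn d`, and then to `X.rot⁻¹ (turn d)`; off the circuit one passes directly to `X.rot⁻¹ d`. So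
the first return to the old darts is the inverse of `turn⁻¹ * rot`, whose cycles are therefore the
vertices of the cut map. -/
theorem IsCircuit.cutClass_eq_of_sameCycle (h : X.IsCircuit m) {x y : X.Dart ⊕ X.CircuitDart}
    (hxy : SameCycle h.cut.rot x y) : h.cutClass x = h.cutClass y := by
  refine setoid_le_ker (p := h.cut.rot⁻¹) ?_ (sameCycle_inv.2 hxy)
  rw [h.cut_rot_inv]
  rintro (d | c)
  · by_cases hd : X.OnCircuit d
    · change h.cutClass (Equiv.Perm.sumCongr X.face h.next (h.cutRevFun (Sum.inl d))) = _
      rw [h.cutRevFun_coe ⟨d, hd⟩]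
      refine Quotient.sound ?_
      change SameCycle _ (X.rot⁻¹ (h.next (h.revStep ⟨d, hd⟩)).1) d
      rw [← h.turn_coe]
      exact h.sameCycle_turn_inv_mul_rot d
    · change h.cutClass (Equiv.Perm.sumCongr X.face h.next (h.cutRevFun (Sum.inl d))) = _
      rw [h.cutRevFun_of_not hd]
      refine Quotient.sound ?_
      change SameCycle _ (X.face (X.rev d)) d
      rw [X.face_rev]
      have := h.sameCycle_turn_inv_mul_rot d
      rwa [h.turn_of_not hd] at this
  · refine Quotient.sound ?_
    change SameCycle _ (X.face (X.rev c)) _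
    rw [X.face_rev]

theorem IsCircuit.sameCycle_cut_inr (h : X.IsCircuit m) (c : X.CircuitDart) :
    SameCycle h.cut.rot (Sum.inl (X.rot⁻¹ c)) (Sum.inr c) := by
  refine sameCycle_inv.1 (SameCycle.symm ⟨1, ?_⟩)
  rw [zpow_one, h.cut_rot_inv]
  change Sum.inl (X.face (X.rev c)) = _
  rw [X.face_rev]

theorem IsCircuit.sameCycle_cut_inl (h : X.IsCircuit m) {x y : X.Dart} (hxy : SameCycle (h.turn⁻¹ * X.rot) x y) :
    SameCycle h.cut.rot (Sum.inl x) (Sum.inl y) := by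
  refine SameCycle.map (p := (h.turn⁻¹ * X.rot)⁻¹) (f := Sum.inl) (fun d => ?_) (sameCycle_inv.2 hxy)
  have hd' : (h.turn⁻¹ * X.rot)⁻¹ d = X.rot⁻¹ (h.turn d) := by simp
  rw [hd']
  have hstep : SameCycle h.cut.rot (Sum.inl d) (h.cut.rot⁻¹ (Sum.inl d)) := ⟨-1, by simp⟩
  by_cases hd : X.OnCircuit d
  · have he : h.cut.rot⁻¹ (Sum.inl d) = Sum.inr (h.next (h.revStep ⟨d, hd⟩)) := by
      rw [h.cut_rot_inv]
      change Equiv.Perm.sumCongr X.face h.next (h.cutRevFun (Sum.inl d)) = _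
      rw [h.cutRevFun_coe ⟨d, hd⟩]
      rfl
    rw [he] at hstep
    have := h.sameCycle_cut_inr (h.next (h.revStep ⟨d, hd⟩))
    rw [← h.turn_coe] at this
    exact hstep.trans this.symm
  · have he : h.cut.rot⁻¹ (Sum.inl d) = Sum.inl (X.rot⁻¹ d) := by
      rw [h.cut_rot_inv]
      change Equiv.Perm.sumCongr X.face h.next (h.cutRevFun (Sum.inl d)) = _
      rw [h.cutRevFun_of_not hd]
      exact congrArg Sum.inl (X.face_rev d)
    rw [he] at hstep
    rwa [h.turn_of_not hd]

theorem IsCircuit.cycleNumber_cut_rot (h : X.IsCircuit m) :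
    cycleNumber h.cut.rot = cycleNumber (h.turn⁻¹ * X.rot) := by
  refine (Setoid.classCount_eq_of_map (Sum.inl : X.Dart → X.Dart ⊕ X.CircuitDart)
    (fun x y => ⟨h.sameCycle_cut_inl, fun hxy => ?_⟩) ?_).symm
  · exact Quotient.exact (h.cutClass_eq_of_sameCycle hxy)
  · rintro (d | c)
    · exact ⟨d, SameCycle.refl _ _⟩
    · exact ⟨_, h.sameCycle_cut_inr c⟩

/-- The boundary consists of the `2 * m` new darts, whose reversals are old darts. So its size and
its bridgelessness are automatic, and only connectedness and Euler's formula remain. -/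
theorem IsCircuit.isBridgelessMap_cut_iff (h : X.IsCircuit m) :
    h.cut.IsBridgelessMap m ↔ h.cut.component = ⊤ ∧
    cycleNumber (h.turn⁻¹ * X.rot) + cycleNumber X.face = cycleNumber X.rev + m + 1 := by
  rw [RotationSystem.IsBridgelessMap, RotationSystem.isPlanarMap_iff, h.cycleNumber_cut_face,
    h.cycleNumber_cut_rev, h.cycleNumber_cut_rot]
  constructor
  · rintro ⟨⟨h1, h2⟩, -⟩
    exact ⟨h1, by omega⟩
  · rintro ⟨h1, h2⟩
    refine ⟨⟨h1, by omega⟩, ?_, ?_⟩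
    · have : {d | h.cut.IsBoundary d} = Set.range (Sum.inr : X.CircuitDart → X.Dart ⊕ _) := by
        ext x
        rcases x with d | c
        · exact iff_of_false (h.not_isBoundary_cut_inl d) (by simp)
        · exact iff_of_true (h.isBoundary_cut_inr c) ⟨c, rfl⟩
      rw [this, ← Set.image_univ, Set.ncard_image_of_injective _ Sum.inr_injective, Set.ncard_univ,
        h.card_circuitDart]
    · rintro (d | c) hx
      · exact absurd hx (h.not_isBoundary_cut_inl d)
      · exact h.not_isBoundary_cut_inl (X.rev c)

/-- If a new dart is sent to the class of its step, every move in the cut map becomes a move inside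
a bubble, possibly followed by a turn. -/
theorem IsCircuit.component_sup_turn (h : X.IsCircuit m) (hc : h.cut.component = ⊤) :
    X.component ⊔ SameCycle.setoid h.turn = ⊤ := by
  let u := X.component ⊔ SameCycle.setoid h.turn
  have hX : X.component ≤ u := le_sup_left
  have hturn : ∀ d, u d (h.turn d) := setoid_le_iff.1 le_sup_right
  let f : X.Dart ⊕ X.CircuitDart → Quotient u :=
    Sum.elim (Quotient.mk u) (fun c => Quotient.mk u c.1)
  have hf : h.cut.component ≤ Setoid.ker f := by
    rw [h.cut.component_eq_sup_face, h.cut_face]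
    refine sup_le (setoid_le_iff.2 ?_) (setoid_le_iff.2 ?_)
    · rintro (d | c)
      · exact Quotient.sound (hX (X.component_face d))
      · refine Quotient.sound (u.trans' (hX (X.component_rev c)) ?_)
        have := hturn (h.revStep c)
        rw [h.turn_coe, show h.revStep (h.revStep c) = c from h.tree.rev_rev c] at this
        exact this
    · rintro (d | c)
      · change f (Sum.inl d) = f (h.cutRevFun (Sum.inl d))
        by_cases hd : X.OnCircuit d
        · rw [h.cutRevFun_coe ⟨d, hd⟩]
          exact Quotient.sound (hX (X.component_rev d))
        · rw [h.cutRevFun_of_not hd]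
          exact Quotient.sound (hX (X.component_rev d))
      · exact Quotient.sound (hX (X.component_rev c))
  refine top_le_iff.1 fun {x y} _ => ?_
  have : h.cut.component (Sum.inl x) (Sum.inl y) := by rw [hc]; trivial
  exact Quotient.exact (hf this)

/-- All new darts lie on one face and their reversals are the old darts of the circuit, so every
bubble visited by the circuit is joined to this face. -/
theorem IsCircuit.component_cut (h : X.IsCircuit m) (hX : ∀ d, ∃ i, X.component d (X.circuit i)) :
    h.cut.component = ⊤ := by
  let w := h.cut.component
  have hinr : ∀ c, w (Sum.inr (X.step 0)) (Sum.inr c) := fun c =>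
    (le_sup_left.trans h.cut.component_eq_sup_face.ge : SameCycle.setoid h.cut.face ≤ w)
      (h.isBoundary_cut_inr c)
  have hrev : ∀ c : X.CircuitDart, w (Sum.inr (X.step 0)) (Sum.inl c) := fun c => by
    refine w.trans' (hinr (h.revStep c)) (w.symm' ?_)
    have := h.cut.component_rev (Sum.inl c.1)
    change w _ (h.cutRevFun (Sum.inl c.1)) at this
    rwa [h.cutRevFun_coe] at this
  have hle : X.component ≤ Setoid.ker fun d => w (Sum.inr (X.step 0)) (Sum.inl d) := by
    rw [X.component_eq_sup_face]
    refine sup_le (setoid_le_iff.2 fun d => propext ?_) (setoid_le_iff.2 fun d => propext ?_)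
    · have : w (Sum.inl d) (Sum.inl (X.face d)) := by
        have := h.cut.component_face (Sum.inl d)
        rwa [h.cut_face] at this
      exact ⟨fun hd => w.trans' hd this, fun hd => w.trans' hd (w.symm' this)⟩
    · by_cases hd : X.OnCircuit d
      · exact iff_of_true (hrev ⟨d, hd⟩) (hrev (h.revStep ⟨d, hd⟩))
      · have : w (Sum.inl d) (Sum.inl (X.rev d)) := by
          have := h.cut.component_rev (Sum.inl d)
          change w _ (h.cutRevFun (Sum.inl d)) at this
          rwa [h.cutRevFun_of_not hd] at this
        exact ⟨fun hd => w.trans' hd this, fun hd => w.trans' hd (w.symm' this)⟩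
  have hall : ∀ x, w (Sum.inr (X.step 0)) x := by
    rintro (d | c)
    · obtain ⟨i, hi⟩ := hX d
      exact cast (hle hi).symm (hrev (X.step i))
    · exact hinr c
  exact le_antisymm le_top fun {x y} _ => w.trans' (w.symm' (hall x)) (hall y)

end DecoratedBubbles

/-! ## Bubble-maps from planarity of the tree and of the cut map, and conversely -/

namespace DecoratedBubbles

/-! ### The incidence graph of bubbles and vertices. -/

section Incidence

variable (X : DecoratedBubbles)

theorem incidence_adj (d : X.Dart) :
    X.incidence.Adj (Sum.inl (Quotient.mk X.component d)) (Sum.inr (Quotient.mk X.vert d)) := by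
  rw [incidence, SimpleGraph.fromRel_adj]
  exact ⟨by simp, Or.inl ⟨d, rfl, rfl⟩⟩

theorem card_edgeSet_incidence :
    Nat.card X.incidence.edgeSet = (X.component ⊓ X.vert).classCount := by
  symm
  refine Setoid.classCount_eq_card
    (fun d => (⟨s(Sum.inl (Quotient.mk X.component d), Sum.inr (Quotient.mk X.vert d)),
      X.incidence.mem_edgeSet.2 (X.incidence_adj d)⟩ : X.incidence.edgeSet)) (fun x y => ?_) ?_
  · rw [Subtype.mk.injEq, Sym2.eq_iff]
    constructor
    · exact fun hxy => Or.inl ⟨congrArg Sum.inl (Quotient.sound hxy.1),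
        congrArg Sum.inr (Quotient.sound hxy.2)⟩
    · rintro (⟨h1, h2⟩ | ⟨h1, h2⟩)
      · exact ⟨Quotient.exact (Sum.inl_injective h1), Quotient.exact (Sum.inr_injective h2)⟩
      · exact absurd h1 (by simp)
  · rintro ⟨e, he⟩
    induction e using Sym2.ind with
    | _ a b =>
    obtain ⟨-, ⟨d, rfl, rfl⟩ | ⟨d, rfl, rfl⟩⟩ := (SimpleGraph.fromRel_adj _ _ _).1 (X.incidence.mem_edgeSet.1 he)
    · exact ⟨d, rfl⟩
    · exact ⟨d, Subtype.ext Sym2.eq_swap⟩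

theorem connected_incidence_iff : X.incidence.Connected ↔ X.component ⊔ X.vert = ⊤ := by
  constructor
  · intro h
    let u := X.component ⊔ X.vert
    let g : X.Bubble ⊕ X.Vertex → Quotient u :=
      Sum.elim (Quotient.map id (le_sup_left : X.component ≤ u))
        (Quotient.map id (le_sup_right : X.vert ≤ u))
    have hadj : ∀ a b, X.incidence.Adj a b → g a = g b := by
      intro a b hab
      obtain ⟨-, ⟨d, rfl, rfl⟩ | ⟨d, rfl, rfl⟩⟩ := (SimpleGraph.fromRel_adj _ _ _).1 hab <;> rfl
    have hreach : ∀ a b, X.incidence.Reachable a b → g a = g b := by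
      rintro a b ⟨w⟩
      induction w with
      | nil => rfl
      | cons hab _ ih => exact (hadj _ _ hab).trans ih
    refine top_le_iff.1 fun {x y} _ => ?_
    exact Quotient.exact (hreach _ _ (h.preconnected (Sum.inl (Quotient.mk _ x))
      (Sum.inl (Quotient.mk _ y))))
  · intro h
    let R : Setoid X.Dart := X.incidence.reachableSetoid.comap
      fun d => Sum.inl (Quotient.mk X.component d)
    have hR : X.component ⊔ X.vert ≤ R := by
      refine sup_le (fun {x y} hxy => ?_) (fun {x y} hxy => ?_)
      · change X.incidence.Reachable (Sum.inl (Quotient.mk X.component x)) _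
        rw [(Quotient.sound hxy : Quotient.mk X.component x = Quotient.mk X.component y)]
      · have h1 := X.incidence_adj x
        rw [(Quotient.sound hxy : Quotient.mk X.vert x = Quotient.mk X.vert y)] at h1
        exact h1.reachable.trans (X.incidence_adj y).symm.reachable
    rw [h] at hR
    have hroot : ∀ a, X.incidence.Reachable (Sum.inl (Quotient.mk X.component X.root)) a := by
      rintro (q | q)
      · obtain ⟨d, rfl⟩ := Quotient.exists_rep q
        exact hR trivial
      · obtain ⟨d, rfl⟩ := Quotient.exists_rep q
        exact SimpleGraph.Reachable.trans (hR (trivial : (⊤ : Setoid X.Dart) X.root d))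
          (X.incidence_adj d).reachable
    have : Nonempty (X.Bubble ⊕ X.Vertex) := ⟨Sum.inl (Quotient.mk _ X.root)⟩
    exact ⟨fun a b => (hroot a).symm.trans (hroot b)⟩

/-- Incidences are the classes of `component ⊓ vert`, so being a tree is connectedness together with
equality in semimodularity. -/
theorem isTree_incidence_iff : X.incidence.IsTree ↔ X.component ⊔ X.vert = ⊤ ∧
    (X.component ⊓ X.vert).classCount + 1 = X.component.classCount + X.vert.classCount := by
  rw [SimpleGraph.isTree_iff_connected_and_card, connected_incidence_iff, card_edgeSet_incidence,
    Nat.card_sum]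
  rfl

end Incidence

/-! ### Planarity of the tree and the cut map against the bubble-map axioms. -/

variable {X : DecoratedBubbles} {m : ℕ}

theorem IsCircuit.sameCycle_turn (h : X.IsCircuit m) (i : ℕ) :
    SameCycle h.turn (X.rev (X.circuit i)) (X.circuit (i + 1)) :=
  ⟨1, by rw [zpow_one, h.turn_rev_circuit]⟩

theorem IsCircuit.exists_rev_circuit (h : X.IsCircuit m) {a : X.Dart} (ha : h.turn a ≠ a) :
    ∃ i, X.rev (X.circuit i) = a := by
  have hC : X.OnCircuit a := by
    by_contra hC
    exact ha (h.turn_of_not hC)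
  obtain ⟨i, hi⟩ := (h.onCircuit_rev a).2 hC
  exact ⟨i, by rw [hi, X.rev_rev]⟩

/-- If the tree and the cut map are planar, all the inequalities between numbers of cycles
are equalities. -/
theorem IsCircuit.tight (h : X.IsCircuit m) (hT : h.tree.IsPlaneTree m)
    (hM : h.cut.IsBridgelessMap m) (hv : X.vert = SameCycle.setoid X.rot ⊔ SameCycle.setoid h.turn) :
    cycleNumber X.rot + cycleNumber h.turn + cycleNumber (h.turn⁻¹ * X.rot) =
        Nat.card X.Dart + 2 * X.vert.classCount ∧
      cycleNumber X.rot + cycleNumber X.face = cycleNumber X.rev + 2 * X.component.classCount ∧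
      SameCycle.setoid X.rot = X.component ⊓ X.vert ∧
      X.incidence.IsTree := by
  have hne : Nonempty X.Dart := ⟨X.root⟩
  rw [h.isPlaneTree_tree_iff] at hT
  obtain ⟨hc, hM⟩ := h.isBridgelessMap_cut_iff.1 hM
  have hturn := h.cycleNumber_turn
  have hrev := X.cycleNumber_rev
  have hgenus := cycleNumber_genus_le h.turn (h.turn⁻¹ * X.rot)
  rw [mul_inv_cancel_left, setoid_sup_inv_mul, sup_comm, ← hv] at hgenus
  have heuler := X.euler_le
  have hrot : SameCycle.setoid X.rot ≤ X.component ⊓ X.vert :=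
    le_inf le_sup_left (hv ▸ le_sup_left)
  have hP : (X.component ⊓ X.vert).classCount ≤ cycleNumber X.rot := Setoid.classCount_le_of_le hrot
  have htop : X.component ⊔ X.vert = ⊤ := top_le_iff.1 (by
    rw [← h.component_sup_turn hc]
    exact sup_le_sup_left (hv ▸ le_sup_right) _)
  have hsub := Setoid.classCount_add_le X.component X.vert
  rw [htop, Setoid.classCount_top] at hsub
  -- Inserting the two planarity counts into `hgenus` and bounding the faces by `heuler` gives
  -- c(rot) + 1 ≤ |component| + |vert|. The opposite inequality follows from `hsub` and `hP`, so
  -- each inequality used is an equality.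
  refine ⟨by omega, by omega, Setoid.eq_of_le_of_classCount_le hrot ?_,
    X.isTree_incidence_iff.2 ⟨htop, by omega⟩⟩
  change cycleNumber X.rot ≤ _
  omega

theorem IsCircuit.isCircuitBubbleMap (h : X.IsCircuit m) (hT : h.tree.IsPlaneTree m)
    (hM : h.cut.IsBridgelessMap m) (hv : X.vert = SameCycle.setoid X.rot ⊔ SameCycle.setoid h.turn) :
    X.IsCircuitBubbleMap m := by
  obtain ⟨hgenus, heuler, hsep, htree⟩ := h.tight hT hM hv
  have hrot : SameCycle.setoid X.rot ≤ X.vert := hv ▸ le_sup_left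
  have hturn : SameCycle.setoid h.turn ≤ X.vert := hv ▸ le_sup_right
  refine ⟨⟨setoid_le_iff.1 hrot, X.forall_isSpherical_iff.2 heuler, fun d d' h1 h2 => ?_, htree⟩,
    h.start, h.length, h.both, fun i => hturn (h.sameCycle_turn i), ?_, ?_⟩
  · exact (hsep ▸ ⟨h1, h2⟩ : SameCycle.setoid X.rot d d')
  -- In a common layout of `rot` and `turn`, noncrossing for `rot` is the layout condition on
  -- bubbles, and noncrossing for `turn` is the condition on the circuit.
  · obtain ⟨ζ, hζ, hζrot, hζturn⟩ := exists_layout_of_genus_zero (ρ := X.rot) (σ := h.turn) (by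
      rw [← hv, ← hgenus, ← cycleNumber_inv (h.turn⁻¹ * X.rot), mul_inv_rev, inv_inv])
    rw [← hv] at hζ
    have hN := isNoncrossing_of_cycleNumber_add (hζ ▸ hrot) hζrot
    refine ⟨ζ, ⟨fun d d' => ?_, hN.induced, hN.noninterlacing⟩, fun i j => ?_⟩
    · rw [← hζ]; rfl
    · have := (isNoncrossing_of_cycleNumber_add (hζ ▸ hturn) hζturn).not_cyclicallyOrdered
        (X.rev (X.circuit i)) (X.rev (X.circuit j))
      rwa [h.turn_rev_circuit, h.turn_rev_circuit] at this
  · rintro d ⟨d', hd, hd'⟩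
    by_contra! hno
    -- If the circuit misses the `rot`-cycle of `d`, then `turn` moves none of its darts, so this
    -- cycle is a whole vertex and there is no pinch point.
    have hle : X.vert ≤ Setoid.ker fun x => SameCycle X.rot d x := by
      rw [hv]
      refine sup_le (setoid_le_iff.2 fun x => propext ?_) (setoid_le_iff.2 fun x => propext ?_)
      · exact sameCycle_apply_right.symm
      · by_cases hx : h.turn x = x
        · rw [hx]
        · obtain ⟨i, rfl⟩ := h.exists_rev_circuit hx
          obtain ⟨j, hj⟩ := h.both i
          rw [h.turn_rev_circuit, ← hj]
          exact iff_of_false (hno j) (hno (i + 1))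
    exact hd' (cast (hle hd) (SameCycle.refl _ _))

theorem IsCircuitBubbleMap.isCircuit (hX : X.IsCircuitBubbleMap m) : X.IsCircuit m :=
  ⟨hX.start, hX.length, hX.both⟩

theorem IsCircuitBubbleMap.setoid_rot (hX : X.IsCircuitBubbleMap m) :
    SameCycle.setoid X.rot = X.component ⊓ X.vert :=
  le_antisymm (le_inf le_sup_left (setoid_le_iff.2 hX.bubbleMap.vert_rot))
    fun {_ _} h => hX.bubbleMap.separated _ _ h.1 h.2

theorem IsCircuitBubbleMap.setoid_turn_le (hX : X.IsCircuitBubbleMap m) :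
    SameCycle.setoid hX.isCircuit.turn ≤ X.vert := by
  refine setoid_le_iff.2 fun x => ?_
  by_cases hx : hX.isCircuit.turn x = x
  · rw [hx]
  · obtain ⟨i, rfl⟩ := hX.isCircuit.exists_rev_circuit hx
    rw [hX.isCircuit.turn_rev_circuit]
    exact hX.chain i

/-- The circuit passes through every bubble. -/
theorem IsCircuitBubbleMap.exists_component_circuit (hX : X.IsCircuitBubbleMap m) (d : X.Dart) :
    ∃ i, X.component d (X.circuit i) := by
  by_contra! hno
  -- An unvisited bubble has no pinch point, so it is closed under the identifications of vertices.
  -- By connectedness it would be everything, including the circuit.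
  have hle : X.component ⊔ X.vert ≤ Setoid.ker fun x => X.component d x := by
    have hpinch : ∀ x y, X.vert x y → X.component d x → X.component d y := by
      intro x y hxy hx
      by_cases hs : SameCycle X.rot x y
      · exact X.component.trans' hx ((le_sup_left : SameCycle.setoid X.rot ≤ X.component) hs)
      · obtain ⟨i, hi⟩ := hX.pinch x ⟨y, hxy, hs⟩
        exact absurd (X.component.trans' hx
          ((le_sup_left : SameCycle.setoid X.rot ≤ X.component) hi)) (hno i)
    refine sup_le (fun {x y} hxy => propext ?_) (fun {x y} hxy => propext ?_)
    · exact ⟨fun hx => X.component.trans' hx hxy,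
        fun hy => X.component.trans' hy (X.component.symm' hxy)⟩
    · exact ⟨hpinch x y hxy, hpinch y x (X.vert.symm' hxy)⟩
  rw [(X.isTree_incidence_iff.1 hX.bubbleMap.tree).1] at hle
  have h1 : (⊤ : Setoid X.Dart) d (X.circuit 0) := trivial
  exact hno 0 (cast (hle h1) (X.component.refl' d))

theorem IsCircuitBubbleMap.planarity (hX : X.IsCircuitBubbleMap m) :
    hX.isCircuit.tree.IsPlaneTree m ∧ hX.isCircuit.cut.IsBridgelessMap m ∧
      X.vert = SameCycle.setoid X.rot ⊔ SameCycle.setoid hX.isCircuit.turn := by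
  set h := hX.isCircuit
  have hne : Nonempty X.Dart := ⟨X.root⟩
  have hnec : Nonempty h.cut.Dart := ⟨h.cut.root⟩
  obtain ⟨ζ, hζ, hcross⟩ := hX.nonCrossing
  have hζv : SameCycle.setoid ζ = X.vert := by ext d d'; exact hζ.cycles d d'
  have hζc : cycleNumber ζ = X.vert.classCount := congrArg Setoid.classCount hζv
  have hrot : SameCycle.setoid X.rot ≤ X.vert := setoid_le_iff.2 hX.bubbleMap.vert_rot
  have hNrot := (isNoncrossing_of_induced_of_noninterlacing (hζv ▸ hrot) hζ.induced
    hζ.noninterlacing).cycleNumber_add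
  have hNturn : IsNoncrossing ζ h.turn := by
    refine isNoncrossing_of_not_cyclicallyOrdered (hζv ▸ hX.setoid_turn_le) fun a b ha hb => ?_
    obtain ⟨i, rfl⟩ := h.exists_rev_circuit ha
    obtain ⟨j, rfl⟩ := h.exists_rev_circuit hb
    rw [h.turn_rev_circuit, h.turn_rev_circuit]
    exact hcross i j
  have hNturn := hNturn.cycleNumber_add
  -- The product of these two permutations is `turn⁻¹ * rot`. With `hNrot` and `hNturn` this gives
  -- c(turn) + c(turn⁻¹ rot) ≥ |D| + 2|vert| - c(rot), which the Euler bounds for the tree and the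
  -- cut map, `htreele` and `hcut`, turn into equality.
  have htriangle := cycleNumber_add_le (h.turn⁻¹ * ζ) (X.rot⁻¹ * ζ)⁻¹
  rw [mul_inv_rev, inv_inv, mul_assoc, mul_inv_cancel_left, ← cycleNumber_inv (ζ⁻¹ * X.rot),
    mul_inv_rev, inv_inv] at htriangle
  have htree := (X.isTree_incidence_iff.1 hX.bubbleMap.tree).2
  rw [← hX.setoid_rot] at htree
  change cycleNumber X.rot + 1 = _ at htree
  have heuler := X.forall_isSpherical_iff.1 hX.bubbleMap.spherical
  have hc := h.component_cut hX.exists_component_circuit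
  have hcut := h.cut.euler_le
  rw [hc, Setoid.classCount_top, h.cycleNumber_cut_rot, h.cycleNumber_cut_face,
    h.cycleNumber_cut_rev] at hcut
  have htreele := h.cycleNumber_tree_rot_le
  have hturn := h.cycleNumber_turn
  have hrev := X.cycleNumber_rev
  have hJ : SameCycle.setoid X.rot ⊔ SameCycle.setoid h.turn ≤ X.vert :=
    sup_le hrot hX.setoid_turn_le
  refine ⟨h.isPlaneTree_tree_iff.2 (by omega), h.isBridgelessMap_cut_iff.2 ⟨hc, by omega⟩,
    (Setoid.eq_of_le_of_classCount_le hJ ?_).symm⟩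
  -- The joint orbits of `rot` and `turn` already connect all bubbles. By semimodularity their
  -- number plus |component| is at most c(rot) + 1 = |component| + |vert|, so `vert` cannot be
  -- coarser.
  have hsub := Setoid.classCount_add_le X.component (SameCycle.setoid X.rot ⊔ SameCycle.setoid h.turn)
  have htop : X.component ⊔ (SameCycle.setoid X.rot ⊔ SameCycle.setoid h.turn) = ⊤ :=
    top_le_iff.1 (by
      rw [← h.component_sup_turn hc]
      exact sup_le_sup_left le_sup_right _)
  have hP : (X.component ⊓ (SameCycle.setoid X.rot ⊔ SameCycle.setoid h.turn)).classCount ≤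
      cycleNumber X.rot := Setoid.classCount_le_of_le (le_inf le_sup_left le_sup_left)
  rw [htop, Setoid.classCount_top] at hsub
  omega

end DecoratedBubbles

/-! ## Isomorphisms of rooted maps -/

/-- Two enumerations with the same repetitions give a bijection. -/
theorem exists_equiv_of_enumerations {A B : Type} {a : ℕ → A} {b : ℕ → B}
    (ha : ∀ x, ∃ i, a i = x) (hb : ∀ y, ∃ i, b i = y) (hab : ∀ i j, a i = a j ↔ b i = b j) :
    ∃ e : A ≃ B, ∀ i, e (a i) = b i := by
  choose f hf using ha
  have hcomp : ∀ i, b (f (a i)) = b i := fun i => (hab _ _).1 (hf _)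
  refine ⟨Equiv.ofBijective (b ∘ f) ⟨fun x y hxy => ?_, fun y => ?_⟩, hcomp⟩
  · rw [← hf x, ← hf y]
    exact (hab _ _).2 hxy
  · obtain ⟨i, rfl⟩ := hb y
    exact ⟨a i, hcomp i⟩

theorem Equiv.Perm.sameCycle_equiv_iff {D E : Type} {p : Equiv.Perm D} {q : Equiv.Perm E} (e : D ≃ E)
    (h : ∀ x, e (p x) = q (e x)) {x y : D} : SameCycle p x y ↔ SameCycle q (e x) (e y) := by
  constructor
  · exact SameCycle.map fun z => ⟨1, by rw [zpow_one, h]⟩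
  · intro hxy
    have := SameCycle.map (q := p) (f := e.symm) (fun z => ⟨1, by
      rw [zpow_one, e.eq_symm_apply, h, e.apply_symm_apply]⟩) hxy
    rwa [e.symm_apply_apply, e.symm_apply_apply] at this

theorem Equiv.Perm.cycleNumber_equiv {D E : Type} {p : Equiv.Perm D} {q : Equiv.Perm E} (e : D ≃ E)
    (h : ∀ x, e (p x) = q (e x)) : cycleNumber p = cycleNumber q :=
  Setoid.classCount_eq_of_map e (fun _ _ => sameCycle_equiv_iff e h) fun z =>
    ⟨e.symm z, by rw [e.apply_symm_apply]⟩

namespace RotationSystem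

variable {X Y : RotationSystem}

theorem map_rot_of_map_face (e : X.Dart ≃ Y.Dart) (hrev : ∀ d, e (X.rev d) = Y.rev (e d))
    (hface : ∀ d, e (X.face d) = Y.face (e d)) (d : X.Dart) : e (X.rot d) = Y.rot (e d) := by
  have key : ∀ (Z : RotationSystem) d, Z.rot (Z.face d) = Z.rev d := fun Z d =>
    congrArg (fun p : Equiv.Perm Z.Dart => p d) Z.rot_mul_face
  obtain ⟨d, rfl⟩ := X.face.surjective d
  rw [key, hface, key, hrev]

theorem map_face_of_map_rot (e : X.Dart ≃ Y.Dart) (hrev : ∀ d, e (X.rev d) = Y.rev (e d))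
    (hrot : ∀ d, e (X.rot d) = Y.rot (e d)) (d : X.Dart) : e (X.face d) = Y.face (e d) := by
  simp only [face, mul_apply]
  rw [Equiv.Perm.eq_inv_iff_eq, ← hrot, ← hrev]
  exact congrArg e (X.rot.apply_symm_apply _)

theorem Iso.cycleNumber_rot (h : Iso X Y) : cycleNumber X.rot = cycleNumber Y.rot :=
  let ⟨e, _, h2, _⟩ := h
  cycleNumber_equiv e h2

theorem Iso.cycleNumber_rev (h : Iso X Y) : cycleNumber X.rev = cycleNumber Y.rev :=
  let ⟨e, h1, _, _⟩ := h
  cycleNumber_equiv e h1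

theorem Iso.cycleNumber_face (h : Iso X Y) : cycleNumber X.face = cycleNumber Y.face :=
  let ⟨e, h1, h2, _⟩ := h
  cycleNumber_equiv e (map_face_of_map_rot e h1 h2)

theorem Iso.component_eq_top (h : Iso X Y) (hX : X.component = ⊤) : Y.component = ⊤ := by
  obtain ⟨e, h1, h2, -⟩ := h
  have hle : X.component ≤ Y.component.comap e := by
    refine sup_le (setoid_le_iff.2 fun d => ?_) (setoid_le_iff.2 fun d => ?_)
    · change Y.component (e d) (e (X.rot d))
      rw [h2]
      exact Y.component_rot _
    · change Y.component (e d) (e (X.rev d))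
      rw [h1]
      exact Y.component_rev _
  rw [hX] at hle
  refine top_le_iff.1 fun {x y} _ => ?_
  have : Y.component (e (e.symm x)) (e (e.symm y)) := hle trivial
  rwa [e.apply_symm_apply, e.apply_symm_apply] at this

theorem Iso.isPlanarMap (h : Iso X Y) (hX : X.IsPlanarMap) : Y.IsPlanarMap := by
  rw [isPlanarMap_iff] at hX ⊢
  exact ⟨h.component_eq_top hX.1, by
    rw [← h.cycleNumber_rot, ← h.cycleNumber_face, ← h.cycleNumber_rev, hX.2]⟩

theorem sameCycle_rev {x y : X.Dart} (h : SameCycle X.rev x y) : y = x ∨ y = X.rev x := by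
  refine mem_of_sameCycle (s := {x, X.rev x}) ?_ h (Or.inl rfl)
  rintro z (rfl | rfl)
  · exact Or.inr rfl
  · exact Or.inl (X.rev_rev x)

theorem boundary_succ (i : ℕ) : X.boundary (i + 1) = X.face (X.boundary i) := by
  rw [boundary, pow_succ', mul_apply]
  rfl

theorem contour_succ (i : ℕ) : X.contour (i + 1) = X.rot (X.rev (X.contour i)) := by
  rw [contour, pow_succ', mul_apply]
  rfl

end RotationSystem

/-- The edges of a map with a bridgeless boundary are the internal edges and the edges of
the boundary. -/
theorem BridgelessMap.edgeCount {m : ℕ} (M : BridgelessMap m) : cycleNumber M.1.rev =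
    cycleCount M.1.rev {d | ¬ M.1.IsBoundary d ∧ ¬ M.1.IsBoundary (M.1.rev d)} + 2 * m := by
  let π := Quotient.mk (SameCycle.setoid M.1.rev)
  have hπ : ∀ x y, π x = π y → y = x ∨ y = M.1.rev x := fun x y h =>
    RotationSystem.sameCycle_rev (Quotient.exact h)
  have hrev : ∀ x, π (M.1.rev x) = π x := fun x =>
    Quotient.sound (⟨-1, by simp⟩ : SameCycle M.1.rev _ _)
  -- By bridgelessness, an edge contains at most one dart of the boundary.
  have hinj : Set.InjOn π {d | M.1.IsBoundary d} := by
    intro x hx y hy hxy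
    rcases hπ x y hxy with h | rfl
    · exact h.symm
    · exact absurd hy (M.2.2.2 x hx)
  have hunion : (Set.univ : Set M.1.Dart) =
      {d | ¬ M.1.IsBoundary d ∧ ¬ M.1.IsBoundary (M.1.rev d)} ∪
        ({d | M.1.IsBoundary d} ∪ {d | M.1.IsBoundary (M.1.rev d)}) := by
    ext d
    simp only [Set.mem_univ, Set.mem_union, Set.mem_ofPred_eq, true_iff]
    tauto
  have himage : π '' {d | M.1.IsBoundary (M.1.rev d)} = π '' {d | M.1.IsBoundary d} := by
    apply Set.Subset.antisymm
    · rintro _ ⟨d, hd, rfl⟩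
      exact ⟨M.1.rev d, hd, hrev d⟩
    · rintro _ ⟨d, hd, rfl⟩
      exact ⟨M.1.rev d, by rwa [Set.mem_ofPred_eq, M.1.rev_rev], hrev d⟩
  have hdisj : Disjoint (π '' {d | ¬ M.1.IsBoundary d ∧ ¬ M.1.IsBoundary (M.1.rev d)})
      (π '' {d | M.1.IsBoundary d}) := by
    rw [Set.disjoint_left]
    rintro _ ⟨x, hx, rfl⟩ ⟨y, hy, hyx⟩
    rcases hπ x y hyx.symm with rfl | rfl
    · exact hx.1 hy
    · exact hx.2 hy
  rw [← cycleCount_univ, cycleCount, hunion, Set.image_union, Set.image_union]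
  change (_ ∪ (π '' _ ∪ π '' _)).ncard = _
  rw [himage, Set.union_self, Set.ncard_union_eq hdisj, hinj.ncard_image, M.2.2.1]
  rfl

/-! ### Isomorphic circuits have isomorphic trees and cut maps. -/

namespace DecoratedBubbles

variable {X Y : DecoratedBubbles} {m : ℕ}

theorem Iso.tree (h : Iso X Y) (hX : X.IsCircuit m) (hY : Y.IsCircuit m) :
    RotationSystem.Iso hX.tree hY.tree := by
  obtain ⟨e, h1, -, -, -, h5⟩ := h
  obtain ⟨f, hf⟩ := exists_equiv_of_enumerations X.exists_step Y.exists_step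
    fun i j => (hX.step_eq_iff i j).trans (hY.step_eq_iff i j).symm
  have hval : ∀ c, (f c).1 = e c.1 := by
    intro c
    obtain ⟨i, rfl⟩ := X.exists_step c
    rw [hf]
    exact (h5 i).symm
  have hrev : ∀ c, f (hX.revStep c) = hY.revStep (f c) := fun c => Subtype.ext (by
    rw [hval]
    exact (h1 c.1).trans (congrArg Y.rev (hval c).symm))
  have hnext : ∀ c, f (hX.next c) = hY.next (f c) := by
    intro c
    obtain ⟨i, rfl⟩ := X.exists_step c
    rw [hX.next_step, hf, hf, hY.next_step]
  exact ⟨f, hrev, fun c => (hnext _).trans (congrArg hY.next (hrev c)), hf 0⟩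

end DecoratedBubbles

namespace DecoratedBubbles

variable {X Y : DecoratedBubbles} {m : ℕ}

/-- The reversal in the cut map of a dart of the circuit. -/
theorem IsCircuit.cut_rev_circuit (h : X.IsCircuit m) (i : ℕ) :
    h.cut.rev (Sum.inl (X.rev (X.circuit i))) = Sum.inr (X.step i) :=
  h.cut.rev_rev (Sum.inr (X.step i))

theorem IsCircuit.cut_rev_of_not (h : X.IsCircuit m) {d : X.Dart} (hd : ¬ X.OnCircuit d) :
    h.cut.rev (Sum.inl d) = Sum.inl (X.rev d) := h.cutRevFun_of_not hd

theorem IsCircuit.exists_rev_circuit_of_onCircuit (h : X.IsCircuit m) {d : X.Dart}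
    (hd : X.OnCircuit d) : ∃ i, X.rev (X.circuit i) = d := by
  obtain ⟨i, hi⟩ := (h.onCircuit_rev d).2 hd
  exact ⟨i, by rw [hi, X.rev_rev]⟩

/-- A map is isomorphic to the cut map if its boundary enumerates the steps of the circuit and
its other darts are the darts of the bubbles. -/
theorem IsCircuit.cut_iso (h : X.IsCircuit m) (M : RotationSystem) (e : h.cut.Dart ≃ M.Dart)
    (hinr : ∀ i, e (Sum.inr (X.step i)) = M.boundary i)
    (hface : ∀ d, e (Sum.inl (X.face d)) = M.face (e (Sum.inl d)))
    (hrev : ∀ d, ¬ X.OnCircuit d → e (Sum.inl (X.rev d)) = M.rev (e (Sum.inl d)))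
    (hcirc : ∀ i, e (Sum.inl (X.rev (X.circuit i))) = M.rev (M.boundary i)) :
    (∀ d, e (h.cut.rev d) = M.rev (e d)) ∧ (∀ d, e (h.cut.rot d) = M.rot (e d)) := by
  have h1 : ∀ d, e (h.cut.rev d) = M.rev (e d) := by
    rintro (d | c)
    · by_cases hd : X.OnCircuit d
      · obtain ⟨i, rfl⟩ := h.exists_rev_circuit_of_onCircuit hd
        rw [h.cut_rev_circuit, hinr, hcirc, M.rev_rev]
      · rw [h.cut_rev_of_not hd, hrev d hd]
    · obtain ⟨i, rfl⟩ := X.exists_step c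
      exact (hcirc i).trans (congrArg M.rev (hinr i).symm)
  refine ⟨h1, RotationSystem.map_rot_of_map_face e h1 ?_⟩
  rw [h.cut_face]
  rintro (d | c)
  · exact hface d
  · obtain ⟨i, rfl⟩ := X.exists_step c
    change e (Sum.inr (h.next (X.step i))) = _
    rw [h.next_step, hinr, hinr, M.boundary_succ]

theorem Iso.cut (h : Iso X Y) (hX : X.IsCircuit m) (hY : Y.IsCircuit m) :
    RotationSystem.Iso hX.cut hY.cut := by
  obtain ⟨e, h1, h2, -, -, h5⟩ := h
  obtain ⟨f, hf⟩ := exists_equiv_of_enumerations X.exists_step Y.exists_step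
    fun i j => (hX.step_eq_iff i j).trans (hY.step_eq_iff i j).symm
  have hOn : ∀ d, Y.OnCircuit (e d) ↔ X.OnCircuit d := by
    intro d
    constructor
    · rintro ⟨i, hi⟩
      exact ⟨i, e.injective ((h5 i).trans hi)⟩
    · rintro ⟨i, rfl⟩
      exact ⟨i, (h5 i).symm⟩
  have hinr : ∀ i, Equiv.sumCongr e f (Sum.inr (X.step i)) = hY.cut.boundary i := fun i =>
    (congrArg Sum.inr (hf i)).trans (hY.boundary_cut i).symm
  obtain ⟨k1, k2⟩ := hX.cut_iso hY.cut (Equiv.sumCongr e f) hinr (fun d => by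
      rw [hY.cut_face]
      exact congrArg Sum.inl (RotationSystem.map_face_of_map_rot e h1 h2 d))
    (fun d hd => (congrArg Sum.inl (h1 d)).trans (hY.cut_rev_of_not (mt (hOn d).1 hd)).symm)
    (fun i => by
      rw [hY.boundary_cut]
      exact congrArg Sum.inl ((h1 _).trans (congrArg Y.rev (h5 i))))
  exact ⟨Equiv.sumCongr e f, k1, k2, hinr 0⟩

/-- Isomorphisms preserve the identifications that are generated by the rotation and the circuit. -/
theorem IsCircuit.sup_turn_map (hX : X.IsCircuit m) (hY : Y.IsCircuit m) (e : X.Dart → Y.Dart)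
    (hrev : ∀ d, e (X.rev d) = Y.rev (e d)) (hrot : ∀ d, e (X.rot d) = Y.rot (e d))
    (hcirc : ∀ i, e (X.circuit i) = Y.circuit i) {x y : X.Dart}
    (hxy : (SameCycle.setoid X.rot ⊔ SameCycle.setoid hX.turn) x y) :
    (SameCycle.setoid Y.rot ⊔ SameCycle.setoid hY.turn) (e x) (e y) := by
  let J := SameCycle.setoid Y.rot ⊔ SameCycle.setoid hY.turn
  have hle : SameCycle.setoid X.rot ⊔ SameCycle.setoid hX.turn ≤ J.comap e := by
    refine sup_le (setoid_le_iff.2 fun d => ?_) (setoid_le_iff.2 fun d => ?_)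
    · change J (e d) (e (X.rot d))
      rw [hrot]
      exact setoid_le_iff.1 le_sup_left _
    · change J (e d) (e (hX.turn d))
      by_cases hd : hX.turn d = d
      · rw [hd]
      · obtain ⟨i, rfl⟩ := hX.exists_rev_circuit hd
        rw [hX.turn_rev_circuit, hrev, hcirc, hcirc]
        exact (le_sup_right : _ ≤ J) (hY.sameCycle_turn i)
  exact hle hxy

end DecoratedBubbles

/-! ## The gluing and the circuit -/

section

variable {m : ℕ} (T : PlaneTree m) (M : BridgelessMap m)

theorem glue_circuit (i : ℕ) : (glue T M).circuit i = M.revBoundary (T.mate i) := rfl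

theorem glue_rev_revBoundary (i : ℕ) :
    (glue T M).rev (M.revBoundary i) = (glue T M).circuit i := glueRevFun_revBoundary T M i

theorem glue_rev_circuit (i : ℕ) : (glue T M).rev ((glue T M).circuit i) = M.revBoundary i :=
  (congrArg (glue T M).rev (glue_rev_revBoundary T M i).symm).trans ((glue T M).rev_rev _)

theorem glue_rev_circuit' (i : ℕ) :
    (glue T M).rev ((glue T M).circuit i) = (glue T M).circuit (T.mate i) :=
  glueRevFun_revBoundary T M (T.mate i)

theorem glue_face : (glue T M).face = M.innerFace := by
  change (glueRev T M * M.innerFace⁻¹)⁻¹ * glueRev T M = _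
  rw [mul_inv_rev, inv_inv, inv_mul_cancel_right]

theorem glue_isCircuit : (glue T M).IsCircuit m where
  start := rfl
  length i j := by
    refine (M.revBoundary_eq_iff _ _).trans ?_
    rw [← T.contour_eq_iff, ← T.contour_eq_iff,
      T.contour_mate, T.contour_mate, T.1.rev.injective.eq_iff]
  both i := ⟨T.mate i, (glue_rev_circuit' T M i).symm⟩

/-- The tree is recovered from the gluing. -/
theorem exists_equiv_tree_glue : ∃ e : T.1.Dart ≃ (glue_isCircuit T M).tree.Dart,
    (∀ d, e (T.1.rev d) = (glue_isCircuit T M).tree.rev (e d)) ∧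
    (∀ d, e (T.1.rot d) = (glue_isCircuit T M).tree.rot (e d)) ∧
    ∀ i, e (T.1.contour i) = (glue T M).step i := by
  have h := glue_isCircuit T M
  obtain ⟨e, he⟩ := exists_equiv_of_enumerations T.exists_contour (glue T M).exists_step
    fun i j => (T.contour_eq_iff i j).trans (h.step_eq_iff i j).symm
  have hrev : ∀ d, e (T.1.rev d) = h.revStep (e d) := by
    intro d
    obtain ⟨i, rfl⟩ := T.exists_contour d
    rw [← T.contour_mate, he, he]
    exact Subtype.ext (glue_rev_circuit' T M i).symm
  refine ⟨e, hrev, fun d => ?_, he⟩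
  obtain ⟨d, rfl⟩ := T.1.rev.surjective d
  obtain ⟨i, rfl⟩ := T.exists_contour d
  rw [← T.1.contour_succ, he, hrev, he]
  change _ = h.next (h.revStep (h.revStep _))
  rw [show h.revStep (h.revStep ((glue T M).step i)) = _ from h.tree.rev_rev _, h.next_step]

theorem iso_tree_glue : RotationSystem.Iso T.1 (glue_isCircuit T M).tree :=
  let ⟨e, h1, h2, h3⟩ := exists_equiv_tree_glue T M
  ⟨e, h1, h2, h3 0⟩

/-- The map is recovered from the gluing. -/
theorem exists_equiv_cut_glue : ∃ e : (glue_isCircuit T M).cut.Dart ≃ M.1.Dart,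
    (∀ d, e ((glue_isCircuit T M).cut.rev d) = M.1.rev (e d)) ∧
    (∀ d, e ((glue_isCircuit T M).cut.rot d) = M.1.rot (e d)) ∧
    (∀ d : M.InnerDart, e (Sum.inl d) = d.1) ∧
    ∀ i, e (Sum.inr ((glue T M).step i)) = M.1.boundary i := by
  classical
  have h := glue_isCircuit T M
  obtain ⟨f, hf⟩ := exists_equiv_of_enumerations (glue T M).exists_step
    (b := fun i => (⟨M.1.boundary i, M.isBoundary_boundary i⟩ : {d // M.1.IsBoundary d}))
    (fun y => let ⟨i, hi⟩ := M.exists_boundary y.2; ⟨i, Subtype.ext hi⟩)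
    fun i j => (h.step_eq_iff i j).trans ((M.boundary_eq_iff i j).symm.trans
      (by rw [Subtype.mk.injEq]))
  let e : M.InnerDart ⊕ (glue T M).CircuitDart ≃ M.1.Dart :=
    ((Equiv.sumComm _ _).trans (Equiv.sumCongr f (Equiv.refl _))).trans (Equiv.sumCompl _)
  have hinl : ∀ d, e (Sum.inl d) = d.1 := fun d => rfl
  have hinr : ∀ i, e (Sum.inr ((glue T M).step i)) = M.1.boundary i := fun i => by
    change (f ((glue T M).step i)).1 = _
    rw [hf]
  obtain ⟨k1, k2⟩ := h.cut_iso M.1 e hinr (fun d => by rw [glue_face]; rfl) (fun d hd => by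
      have hd' : ¬ M.1.IsBoundary (M.1.rev d.1) := fun hb => by
        obtain ⟨i, rfl⟩ := M.exists_revBoundary hb
        exact hd ((h.onCircuit_rev _).1 ⟨i, (glue_rev_revBoundary T M i).symm⟩)
      change (glueRevFun T M d).1 = _
      rw [glueRevFun_of_not T M hd']
      rfl) (fun i => by rw [glue_rev_circuit]; rfl)
  exact ⟨e, k1, k2, hinl, hinr⟩

theorem iso_cut_glue : RotationSystem.Iso (glue_isCircuit T M).cut M.1 :=
  let ⟨e, h1, h2, _, h3⟩ := exists_equiv_cut_glue T M
  ⟨e, h1, h2, h3 0⟩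

theorem glue_tree_isPlaneTree : (glue_isCircuit T M).tree.IsPlaneTree m := by
  have h := glue_isCircuit T M
  have hp := (iso_tree_glue T M).isPlanarMap T.2.1
  rw [RotationSystem.isPlanarMap_iff, h.cycleNumber_tree_face, h.cycleNumber_tree_rev] at hp
  exact h.isPlaneTree_tree_iff.2 (by omega)

theorem glue_cut_isBridgelessMap : (glue_isCircuit T M).cut.IsBridgelessMap m := by
  have h := glue_isCircuit T M
  have hp := (RotationSystem.iso_equivalence.symm (iso_cut_glue T M)).isPlanarMap M.2.1
  rw [RotationSystem.isPlanarMap_iff, h.cycleNumber_cut_face, h.cycleNumber_cut_rev,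
    h.cycleNumber_cut_rot] at hp
  exact h.isBridgelessMap_cut_iff.2 ⟨hp.1, by omega⟩

theorem RotationSystem.rot_boundary_succ (X : RotationSystem) (i : ℕ) :
    X.rot (X.boundary (i + 1)) = X.rev (X.boundary i) := by
  rw [boundary_succ]
  exact congrArg (fun p : Equiv.Perm X.Dart => p (X.boundary i)) X.rot_mul_face

/-- The vertices of `M` correspond to the cycles of `turn⁻¹ * rot`, and those of `T` to the cycles
of `turn` on the circuit. These two permutations generate the same orbits as `rot` and `turn`. -/
theorem glue_vert : (glue T M).vert =
    SameCycle.setoid (glue T M).rot ⊔ SameCycle.setoid (glue_isCircuit T M).turn := by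
  set X := glue T M with hX
  have h : X.IsCircuit m := glue_isCircuit T M
  obtain ⟨e, he1, he2, he3, he4⟩ := exists_equiv_cut_glue T M
  obtain ⟨f, hf1, hf2, hf3⟩ := exists_equiv_tree_glue T M
  let J := SameCycle.setoid X.rot ⊔ SameCycle.setoid h.turn
  apply le_antisymm
  · have hJ : SameCycle.setoid (h.turn⁻¹ * X.rot) ≤ J := setoid_inv_mul_le le_sup_right le_sup_left
    let g : X.Dart ⊕ X.CircuitDart → Quotient J := fun x => Quotient.map id hJ (h.cutClass x)
    have hg : ∀ x y, Relation.EqvGen (TailIdentified T M) x y → g (e.symm x) = g (e.symm y) := by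
      intro x y hxy
      induction hxy with
      | rel x y hxy =>
        rcases hxy with hxy | ⟨i, j, rfl, rfl, hij⟩
        · refine congrArg (Quotient.map id hJ) (h.cutClass_eq_of_sameCycle ?_)
          rw [sameCycle_equiv_iff e he2, e.apply_symm_apply, e.apply_symm_apply]
          exact hxy
        · rw [← he4, ← he4, e.symm_apply_apply, e.symm_apply_apply]
          have hrot : ∀ d, J (X.rot⁻¹ d) d := fun d => by
            have := setoid_le_iff.1 (le_sup_left : SameCycle.setoid X.rot ≤ J) (X.rot⁻¹ d)
            rwa [show X.rot (X.rot⁻¹ d) = d from X.rot.apply_symm_apply d] at this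
          have hturn : SameCycle h.turn (X.circuit i) (X.circuit j) := by
            rw [sameCycle_equiv_iff f hf2, hf3, hf3] at hij
            refine hij.map (f := Subtype.val) fun c => ⟨1, ?_⟩
            rw [zpow_one, h.turn_coe]
            rfl
          exact Quotient.sound (J.trans' (hrot _) (J.trans'
            ((le_sup_right : SameCycle.setoid h.turn ≤ J) hturn) (J.symm' (hrot _))))
      | refl x => rfl
      | symm x y _ ih => exact ih.symm
      | trans x y z _ _ ih1 ih2 => exact ih1.trans ih2
    intro x y hxy
    have := hg x.1 y.1 hxy
    rw [e.symm_apply_eq.2 (he3 x).symm, e.symm_apply_eq.2 (he3 y).symm] at this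
    exact Quotient.exact this
  · have hrot : ∀ x y, SameCycle M.1.rot x y → Relation.EqvGen (TailIdentified T M) x y :=
      fun x y hxy => .rel _ _ (Or.inl hxy)
    have hturn : SameCycle.setoid h.turn ≤ X.vert := by
      refine setoid_le_iff.2 fun d => ?_
      by_cases hd : h.turn d = d
      · rw [hd]
      obtain ⟨i, rfl⟩ := h.exists_rev_circuit hd
      rw [h.turn_rev_circuit, hX, glue_rev_circuit, glue_circuit]
      have hb : ∀ i, Relation.EqvGen (TailIdentified T M) (M.1.boundary (i + 1))
          (M.revBoundary i).1 := fun i => hrot _ _ ⟨1, by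
        rw [zpow_one, M.1.rot_boundary_succ]
        rfl⟩
      -- By `hb`, the reversal of e_i starts where the boundary step `i + 1` does, and e_{i+1}
      -- starts where the boundary step `T.mate (i + 1) + 1` does. In the tree, the contour step
      -- `T.mate (i + 1) + 1` is the rotation of step `i + 1`.
      refine .trans _ _ _ (.symm _ _ (hb i)) (.trans _ _ _ (.rel _ _ (Or.inr
        ⟨i + 1, T.mate (i + 1) + 1, rfl, rfl, 1, ?_⟩)) (hb _))
      rw [zpow_one, T.1.contour_succ (T.mate (i + 1)), T.contour_mate, T.1.rev_rev]
    refine sup_le ?_ hturn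
    have hvert : SameCycle.setoid (h.turn⁻¹ * X.rot) ≤ X.vert := fun {x y} hxy => by
      refine hrot _ _ ?_
      exact (congrArg₂ (SameCycle M.1.rot) (he3 x) (he3 y)).mp
        ((sameCycle_equiv_iff e he2).1 (h.sameCycle_cut_inl hxy))
    rw [← mul_inv_cancel_left h.turn X.rot]
    exact setoid_mul_le hturn hvert

theorem glue_isCircuitBubbleMap : (glue T M).IsCircuitBubbleMap m :=
  (glue_isCircuit T M).isCircuitBubbleMap (glue_tree_isPlaneTree T M)
    (glue_cut_isBridgelessMap T M) (glue_vert T M)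

theorem glue_faceCount : M.1.faceCount = (glue T M).faceCount + 1 := by
  rw [RotationSystem.faceCount, RotationSystem.faceCount, cycleCount_univ, cycleCount_univ,
    ← (iso_cut_glue T M).cycleNumber_face, (glue_isCircuit T M).cycleNumber_cut_face]

/-- Cutting doubles the `m` edges of the circuit, which become the `2 * m` boundary edges of `M`. -/
theorem glue_edgeCount : (glue T M).edgeCount =
    cycleCount M.1.rev {d | ¬ M.1.IsBoundary d ∧ ¬ M.1.IsBoundary (M.1.rev d)} + m := by
  have h1 := M.edgeCount
  have h2 := (iso_cut_glue T M).cycleNumber_rev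
  rw [(glue_isCircuit T M).cycleNumber_cut_rev] at h2
  rw [RotationSystem.edgeCount, cycleCount_univ]
  omega

/-- The boundary and the tree never identify a vertex of the boundary with itself if the
gluing is a map. -/
theorem not_sameCycle_contour_of_isMap (hmap : (glue T M).IsMap) (i j : ℕ)
    (hij : ¬ i ≡ j [MOD 2 * m]) (hb : SameCycle M.1.rot (M.1.boundary i) (M.1.boundary j)) :
    ¬ SameCycle T.1.rot (T.1.contour i) (T.1.contour j) := by
  intro ht
  set X := glue T M
  have h : X.IsCircuit m := glue_isCircuit T M
  have hv : X.vert = SameCycle.setoid X.rot ⊔ SameCycle.setoid h.turn := glue_vert T M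
  obtain ⟨hgenus, -, -, -⟩ :=
    h.tight (glue_tree_isPlaneTree T M) (glue_cut_isBridgelessMap T M) hv
  have hrot : X.vert = SameCycle.setoid X.rot := Setoid.ext fun d d' => hmap.2 d d'
  have hsub := Setoid.classCount_add_le (SameCycle.setoid h.turn)
    (SameCycle.setoid (h.turn⁻¹ * X.rot))
  rw [setoid_sup_inv_mul, sup_comm (SameCycle.setoid h.turn) (SameCycle.setoid X.rot), ← hv, hrot]
    at hsub
  rw [hrot] at hgenus
  -- Without pinch points the joint orbits of `turn` and `turn⁻¹ * rot` are the cycles of `rot`.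
  -- Genus zero and semimodularity then leave |D| classes for the meet: a cycle of one and a cycle
  -- of the other share at most one dart.
  have hbot : (⊥ : Setoid X.Dart) =
      SameCycle.setoid h.turn ⊓ SameCycle.setoid (h.turn⁻¹ * X.rot) := by
    refine Setoid.eq_of_le_of_classCount_le bot_le ?_
    rw [Setoid.classCount_bot]
    simp only [cycleNumber] at hgenus
    omega
  obtain ⟨e, he1, he2, he3, he4⟩ := exists_equiv_cut_glue T M
  obtain ⟨f, hf1, hf2, hf3⟩ := exists_equiv_tree_glue T M
  have hturn : SameCycle h.turn (X.circuit i) (X.circuit j) := by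
    rw [sameCycle_equiv_iff f hf2, hf3, hf3] at ht
    refine ht.map (f := Subtype.val) fun c => ⟨1, ?_⟩
    rw [zpow_one, h.turn_coe]
    rfl
  rw [← he4, ← he4, ← sameCycle_equiv_iff e he2] at hb
  have hcut : SameCycle (h.turn⁻¹ * X.rot) (X.rot⁻¹ (X.circuit i)) (X.rot⁻¹ (X.circuit j)) :=
    Quotient.exact (h.cutClass_eq_of_sameCycle hb)
  -- The boundary dart of step `i` is represented by `X.rot⁻¹ (X.circuit i)`, which is not in
  -- general in the `turn`-cycle of the step. Moving to `turn⁻¹ (X.circuit i)` gives a dart that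
  -- lies in both relevant cycles.
  have hback : ∀ d, SameCycle (h.turn⁻¹ * X.rot) (X.rot⁻¹ d) (h.turn⁻¹ d) := fun d =>
    ⟨1, by simp⟩
  have hboth : (SameCycle.setoid h.turn ⊓ SameCycle.setoid (h.turn⁻¹ * X.rot))
      (h.turn⁻¹ (X.circuit i)) (h.turn⁻¹ (X.circuit j)) :=
    ⟨SameCycle.trans ⟨1, by simp⟩ (hturn.trans ⟨-1, by simp⟩), ((hback _).symm.trans hcut).trans (hback _)⟩
  rw [← hbot] at hboth
  exact hij ((h.length i j).1 (h.turn⁻¹.injective hboth))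

end

/-! ### Gluing inverts cutting. -/

namespace DecoratedBubbles

variable {X : DecoratedBubbles} {m : ℕ}

/-- A bubble-map with a circuit is the gluing of its tree and of its cut map. -/
theorem IsCircuit.iso_glue (h : X.IsCircuit m) (hT : h.tree.IsPlaneTree m)
    (hM : h.cut.IsBridgelessMap m)
    (hv : X.vert = SameCycle.setoid X.rot ⊔ SameCycle.setoid h.turn) :
    Iso X (glue ⟨h.tree, hT⟩ ⟨h.cut, hM⟩) := by
  let T : PlaneTree m := ⟨h.tree, hT⟩
  let M : BridgelessMap m := ⟨h.cut, hM⟩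
  -- The old darts are exactly the darts off the boundary of the cut map, which are the darts of the
  -- gluing.
  let f : X.Dart ≃ (glue T M).Dart := Equiv.ofBijective
    (fun d => (⟨Sum.inl d, h.not_isBoundary_cut_inl d⟩ : M.InnerDart))
    ⟨fun x y hxy => Sum.inl_injective (congrArg Subtype.val hxy), by
      rintro ⟨d | c, hx⟩
      · exact ⟨d, rfl⟩
      · exact absurd (h.isBoundary_cut_inr c) hx⟩
  have hrb : ∀ i, f (X.rev (X.circuit i)) = M.revBoundary i := by
    intro i
    refine Subtype.ext ?_
    change _ = h.cut.rev (h.cut.boundary i)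
    rw [h.boundary_cut]
    rfl
  have hmate : ∀ i, X.rev (X.circuit (T.mate i)) = X.circuit i := by
    intro i
    have h1 : T.1.contour (T.mate i) = T.1.rev (T.1.contour i) := T.contour_mate i
    have h2 : X.step (T.mate i) = h.revStep (X.step i) := by
      rw [← h.contour_tree, ← h.contour_tree]
      exact h1
    exact (congrArg (fun c => X.rev c.1) h2).trans (X.rev_rev _)
  have hcirc : ∀ i, f (X.circuit i) = (glue T M).circuit i := by
    intro i
    rw [glue_circuit, ← hrb, hmate]
  have hrev : ∀ d, f (X.rev d) = (glue T M).rev (f d) := by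
    intro d
    by_cases hd : X.OnCircuit d
    · obtain ⟨i, rfl⟩ := h.exists_rev_circuit_of_onCircuit hd
      rw [hrb, glue_rev_revBoundary, X.rev_rev, hcirc]
    · have hd' : ¬ M.1.IsBoundary (M.1.rev (f d).1) := by
        change ¬ h.cut.IsBoundary (h.cut.rev (Sum.inl d))
        rw [h.cut_rev_of_not hd]
        exact h.not_isBoundary_cut_inl _
      change _ = glueRevFun T M (f d)
      rw [glueRevFun_of_not T M hd']
      exact Subtype.ext (h.cut_rev_of_not hd).symm
  have hface : ∀ d, f (X.face d) = (glue T M).face (f d) := by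
    intro d
    rw [glue_face]
    refine Subtype.ext ?_
    change _ = h.cut.face (Sum.inl d)
    rw [h.cut_face]
    rfl
  have hrot := RotationSystem.map_rot_of_map_face (Y := (glue T M).toRotationSystem) f hrev hface
  have hroot : f X.root = (glue T M).root := by
    rw [← h.start, hcirc]
    rfl
  refine ⟨f, hrev, hrot, hroot, fun d d' => ?_, hcirc⟩
  rw [hv, glue_vert T M]
  constructor
  · exact h.sup_turn_map (glue_isCircuit T M) f hrev hrot hcirc
  · intro hdd
    have := (glue_isCircuit T M).sup_turn_map h f.symm
      (fun d => by rw [Equiv.symm_apply_eq, hrev, Equiv.apply_symm_apply])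
      (fun d => by rw [Equiv.symm_apply_eq, hrot, Equiv.apply_symm_apply])
      (fun i => by rw [Equiv.symm_apply_eq, hcirc]) hdd
    rwa [Equiv.symm_apply_apply, Equiv.symm_apply_apply] at this

end DecoratedBubbles

/-- The tree and the cut map are isomorphism invariants of the decorated bubble-map, and for a
gluing they are `T` and `M`. -/
theorem gluing_injective (m : ℕ) : Function.Injective (gluing m) := by
  rintro ⟨t, q⟩ ⟨t', q'⟩ h
  obtain ⟨T, rfl⟩ := Quotient.exists_rep t
  obtain ⟨T', rfl⟩ := Quotient.exists_rep t'
  obtain ⟨M, rfl⟩ := Quotient.exists_rep q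
  obtain ⟨M', rfl⟩ := Quotient.exists_rep q'
  have hiso : DecoratedBubbles.Iso (glue T M) (glue T' M') := Quotient.exact h
  have e := RotationSystem.iso_equivalence
  refine Prod.ext (Quotient.sound ?_) (Quotient.sound ?_)
  · exact e.trans (e.trans (iso_tree_glue T M)
      (hiso.tree (glue_isCircuit T M) (glue_isCircuit T' M'))) (e.symm (iso_tree_glue T' M'))
  · exact e.trans (e.trans (e.symm (iso_cut_glue T M))
      (hiso.cut (glue_isCircuit T M) (glue_isCircuit T' M'))) (iso_cut_glue T' M')

theorem DecoratedBubbles.IsCircuitBubbleMap.exists_glue {X : DecoratedBubbles} {m : ℕ}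
    (hX : X.IsCircuitBubbleMap m) :
    ∃ (T : PlaneTree m) (M : BridgelessMap m), DecoratedBubbles.Iso (glue T M) X :=
  let ⟨hT, hM, hv⟩ := hX.planarity
  ⟨_, _, DecoratedBubbles.iso_equivalence.symm (hX.isCircuit.iso_glue hT hM hv)⟩

theorem DecoratedBubbles.Iso.faceCount {X Y : DecoratedBubbles} (h : DecoratedBubbles.Iso X Y) :
    X.faceCount = Y.faceCount := by
  obtain ⟨e, h1, h2, -⟩ := h
  rw [RotationSystem.faceCount, RotationSystem.faceCount, cycleCount_univ, cycleCount_univ]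
  exact cycleNumber_equiv e (RotationSystem.map_face_of_map_rot e h1 h2)

theorem DecoratedBubbles.Iso.edgeCount {X Y : DecoratedBubbles} (h : DecoratedBubbles.Iso X Y) :
    X.edgeCount = Y.edgeCount := by
  obtain ⟨e, h1, -⟩ := h
  rw [RotationSystem.edgeCount, RotationSystem.edgeCount, cycleCount_univ, cycleCount_univ]
  exact cycleNumber_equiv e h1

theorem mainTheorem10 (m : ℕ) :
    (∀ (T : PlaneTree m) (M : BridgelessMap m), (glue T M).IsMap →
      ∀ i j : ℕ, ¬ i ≡ j [MOD 2 * m] →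
        SameCycle M.1.rot (M.1.boundary i) (M.1.boundary j) →
        ¬ SameCycle T.1.rot (T.1.contour i) (T.1.contour j)) ∧
    (∀ f : ℕ, Set.BijOn (gluing m) (Set.univ ×ˢ boundaryMapsByFaces f m)
      (circuitBubbleMapsByFaces f m)) ∧
    (∀ e : ℕ, Set.BijOn (gluing m) (Set.univ ×ˢ boundaryMapsByEdges e m)
      (circuitBubbleMapsByEdges (e + m) m)) := by
  refine ⟨not_sameCycle_contour_of_isMap,
    fun f => ⟨?_, (gluing_injective m).injOn, ?_⟩, fun e => ⟨?_, (gluing_injective m).injOn, ?_⟩⟩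
  · rintro ⟨t, q⟩ ⟨-, M, rfl, hM⟩
    obtain ⟨T, rfl⟩ := Quotient.exists_rep t
    rw [glue_faceCount T M] at hM
    exact ⟨glue T M, rfl, glue_isCircuitBubbleMap T M, Nat.succ_injective hM⟩
  · rintro _ ⟨X, rfl, hX, hf⟩
    obtain ⟨T, M, hiso⟩ := hX.exists_glue
    refine ⟨(Quotient.mk _ T, Quotient.mk _ M), ⟨trivial, M, rfl, ?_⟩, Quotient.sound hiso⟩
    rw [glue_faceCount T M, hiso.faceCount, hf]
  · rintro ⟨t, q⟩ ⟨-, M, rfl, hM⟩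
    obtain ⟨T, rfl⟩ := Quotient.exists_rep t
    exact ⟨glue T M, rfl, glue_isCircuitBubbleMap T M, by rw [glue_edgeCount, hM]⟩
  · rintro _ ⟨X, rfl, hX, he⟩
    obtain ⟨T, M, hiso⟩ := hX.exists_glue
    refine ⟨(Quotient.mk _ T, Quotient.mk _ M), ⟨trivial, M, rfl, ?_⟩, Quotient.sound hiso⟩
    have := glue_edgeCount T M
    rw [hiso.edgeCount, he] at this
    omega
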